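/- Let $p$ be a prime, $k$ an algebraically closed field of characteristic $p$, $K_0 = \mathrm{Frac}(W(k))$ the fraction field of the ring of Witt vectors of $k$, and $K_n = K_0(\zeta_{p^n})$ for $n \ge 0$, where $\zeta_{p^n}$ is a primitive $p^n$-th root of unity in a fixed algebraic closure of $K_0$. For a finite extension $K/K_0$ let $v_K$ be its valuation normalized so that uniformizers have valuation $1$, put $e_K = v_K(p)$, and write $v_n = v_{K_n}$. For $K \supseteq K_1$, an element $a = 1+t$ of $K$ is called *$p$-primitive for $K$* if either $p \nmid v_K(a)$ (so $a\neq 0$), or $0 < v_K(t) < \frac{p}{p-1}e_K$ and $p \nmid v_K(t)$. For a finite Galois extension $L/K$ of such fields with group $G$, the lower ramification groups are $G_i = \{g \in G : v_L(g\pi_L - \pi_L) \ge i+1\}$ for real $i \ge 0$, where $\pi_L$ is a uniformizer of $L$. The upper ramification groups are $G^i = G_{\psi_{L/K}(i)}$, where $\psi_{L/K}$ is the inverse of $\varphi_{L/K}(u) = \int_0^u \frac{dt}{(G_0:G_t)}$ on $[0,\infty)$. The *conductor* of $L/K$ is $h_{L/K} = \sup\{i \in [0,\infty) : G^i \ne \{\mathrm{id}\}\}$,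 with $h_{L/K}=0$ if $L=K$. **Lemma.** Let $1 \le \ell \le c$ be integers, and let $a = 1+t \in K_\ell$ be $p$-primitive for $K_\ell$, with $v_\ell(a) \ge 0$. Let $\sqrt[p^c]{a}$ be any $p^c$-th root of $a$ in the algebraic closure, and put $\sqrt[p^{c-1}]{a} = (\sqrt[p^c]{a})^p$. Then the extensions $K_c(\sqrt[p^c]{a})/K_\ell(\sqrt[p^c]{a})$ and $K_\ell(\sqrt[p^c]{a})/K_\ell(\sqrt[p^{c-1}]{a})$ are Galois, $v_\ell(t)$ is finite, the conductor of $K_c(\sqrt[p^c]{a})$ over $K_\ell(\sqrt[p^c]{a})$ is at most $p^{c+\ell-1} - v_\ell(t)$, and the conductor of $K_\ell(\sqrt[p^c]{a})$ over $K_\ell(\sqrt[p^{c-1}]{a})$ is equal to $p^{c+\ell-1} - v_\ell(t)$. -/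

import Mathlib

noncomputable section

namespace WildConductor

/-! ### Valuation, higher ramification, conductor

`A` is a complete discrete valuation ring with algebraically closed residue field, and `L` is a
finite extension of its fraction field.  The ring of integers of `L` is the integral closure of `A`
in `L`; it is again a complete discrete valuation ring, with the same residue field. -/

section Ramification

variable (A : Type*) [CommRing A] (L : Type*) [Field L] [Algebra A L]

/-- The uniformizers of `L`: the irreducible elements of its ring of integers. -/
def IsUniformizer (π : integralClosure A L) : Prop := Irreducible π

/-- `x = π ^ n * u` for some uniformizer `π` of `L` and some unit `u` of the ring of integers. -/
def HasVal (x : L) (n : ℤ) : Prop :=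
  ∃ (π : integralClosure A L) (u : (integralClosure A L)ˣ),
    IsUniformizer A L π ∧ x = (π : L) ^ n * ((u : integralClosure A L) : L)

open Classical in
/-- The valuation `v_L`, normalized so that uniformizers have valuation `1`: the integer `n` with
`x = π ^ n * u`, and `⊤` if there is none (that is, if `x = 0`). -/
def val (x : L) : WithTop ℤ :=
  if h : ∃ n : ℤ, HasVal A L x n then ((h.choose : ℤ) : WithTop ℤ) else ⊤

/-- `a = 1 + t` is `p`-primitive for `L`: either `p ∤ v_L(a)` (in particular `a ≠ 0`), or
`0 < v_L(t) < p / (p - 1) * e_L` and `p ∤ v_L(t)`, where `e_L = v_L(p)`. -/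
def IsPrimitiveElt (p : ℕ) (a : L) : Prop :=
  (∃ n : ℤ, val A L a = n ∧ ¬ (p : ℤ) ∣ n) ∨
  (∃ n e : ℤ, val A L (a - 1) = n ∧ val A L (p : L) = e ∧
    0 < n ∧ (n : ℝ) < (p : ℝ) / ((p : ℝ) - 1) * (e : ℝ) ∧ ¬ (p : ℤ) ∣ n)

variable (M : Type*) [Field M] [Algebra M L]

/-- The `i`-th ramification group `G_i` of `L/M` in the lower numbering (`i ≥ 0` real), as a subset
of the Galois group: `g ∈ G_i` iff `v_L(g π - π) ≥ i + 1` for the uniformizers `π` of `L`.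
(As `L/M` is totally ramified, it makes no difference which uniformizer is tested.) -/
def lowerRam (i : ℝ) : Set (L ≃ₐ[M] L) :=
  {g | ∀ π : integralClosure A L, IsUniformizer A L π →
    ((i + 1 : ℝ) : WithTop ℝ) ≤ (val A L (g (π : L) - (π : L))).map (fun n : ℤ => (n : ℝ))}

/-- The Herbrand function `φ_{L/M}(u) = ∫_0^u dt / (G_0 : G_t)`. -/
def phi (u : ℝ) : ℝ :=
  ∫ t in (0 : ℝ)..u, ((lowerRam A L M t).ncard : ℝ) / ((lowerRam A L M 0).ncard : ℝ)

/-- `ψ_{L/M}`, the inverse of `φ_{L/M}` on `[0, ∞)`. -/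
def psi : ℝ → ℝ := Function.invFunOn (phi A L M) (Set.Ici 0)

/-- The `i`-th ramification group in the upper numbering, `G^i = G_{ψ(i)}`. -/
def upperRam (i : ℝ) : Set (L ≃ₐ[M] L) := lowerRam A L M (psi A L M i)

/-- The conductor `h_{L/M}`: the supremum of the `i ∈ [0, ∞)` with `G^i ≠ {id}` (it is `0` for the
trivial extension, as `sSup ∅ = 0`). -/
def ramConductor : ℝ := sSup {i : ℝ | 0 ≤ i ∧ upperRam A L M i ≠ {1}}

end Ramification

/-! ### The fields `K_n` and `K_n(β)` -/

section Fields

open IntermediateField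

variable (p : ℕ) [Fact p.Prime] (k : Type*) [Field k] [CharP k p]

/-- `K_0 = Frac(W(k))`. -/
abbrev K0 : Type _ := FractionRing (WittVector p k)

/-- An algebraic closure of `K_0`, in which all fields are taken. -/
abbrev Kbar : Type _ := AlgebraicClosure (K0 p k)

/-- `K_n = K_0(ζ_{p^n})`, obtained by adjoining all `p^n`-th roots of unity to `K_0`. -/
def cyc (n : ℕ) : IntermediateField (K0 p k) (Kbar p k) :=
  adjoin (K0 p k) {ζ | ζ ^ (p ^ n) = 1}

/-- `K_n(β)`. -/
def cycAdjoin (n : ℕ) (β : Kbar p k) : IntermediateField (K0 p k) (Kbar p k) :=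
  (adjoin (cyc p k n) {β}).restrictScalars (K0 p k)

variable {p k}

theorem cyc_mono {m n : ℕ} (h : m ≤ n) : cyc p k m ≤ cyc p k n := by
  refine adjoin.mono _ _ _ fun ζ hζ => ?_
  obtain ⟨d, hd⟩ := pow_dvd_pow p h
  simp only [Set.mem_ofPred_eq] at hζ ⊢
  rw [hd, pow_mul, hζ, one_pow]

theorem cycAdjoin_le {m n : ℕ} (h : m ≤ n) {β γ : Kbar p k} (hβ : β ∈ cycAdjoin p k n γ) :
    cycAdjoin p k m β ≤ cycAdjoin p k n γ := by
  intro x hx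
  have hx' : x ∈ adjoin (cyc p k m) {β} := hx
  refine adjoin_induction (cyc p k m) (p := fun x _ => x ∈ cycAdjoin p k n γ)
    ?_ ?_ ?_ ?_ ?_ hx'
  · rintro y rfl
    exact hβ
  · intro y
    exact (adjoin (cyc p k n) {γ}).algebraMap_mem ⟨y, cyc_mono h y.2⟩
  · intro y z _ _ hy hz
    exact add_mem hy hz
  · intro y _ hy
    exact inv_mem hy
  · intro y z _ _ hy hz
    exact mul_mem hy hz

theorem self_mem_cycAdjoin (n : ℕ) (β : Kbar p k) : β ∈ cycAdjoin p k n β :=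
  mem_adjoin_simple_self (cyc p k n) β

/-- `K_m(β) ⊆ K_n(β)` for `m ≤ n`. -/
theorem cycAdjoin_mono {m n : ℕ} (h : m ≤ n) (β : Kbar p k) :
    cycAdjoin p k m β ≤ cycAdjoin p k n β :=
  cycAdjoin_le h (self_mem_cycAdjoin n β)

/-- `K_n(β ^ j) ⊆ K_n(β)`. -/
theorem cycAdjoin_pow_le (n j : ℕ) (β : Kbar p k) :
    cycAdjoin p k n (β ^ j) ≤ cycAdjoin p k n β :=
  cycAdjoin_le le_rfl (pow_mem (self_mem_cycAdjoin n β) j)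

/-- For `M ⊆ L ⊆ Kbar`: the extension `L/M` is Galois. -/
def IsGaloisExt {M L : IntermediateField (K0 p k) (Kbar p k)} (h : M ≤ L) : Prop :=
  letI : Algebra M L := (inclusion h).toRingHom.toAlgebra
  IsGalois M L

/-- For `M ⊆ L ⊆ Kbar`, both finite over `K_0`: the conductor of `L/M`. -/
def relConductor {M L : IntermediateField (K0 p k) (Kbar p k)} (h : M ≤ L) : ℝ :=
  letI : Algebra M L := (inclusion h).toRingHom.toAlgebra
  ramConductor (WittVector p k) L M

variable (p k)

/-- `v_n`, the normalized valuation of `K_n`. -/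
def cycVal (n : ℕ) (x : cyc p k n) : WithTop ℤ := val (WittVector p k) (cyc p k n) x

end Fields

end WildConductor

end

/-
Let `w` be the `p`-adic absolute value of `Kbar`. As `k` is algebraically closed, the ring of
integers of a finite extension `E` of `K_0` is `W(k)[ϖ]` for any uniformizer `ϖ`, so ramification is
measured by `w (g ϖ - ϖ)`. For a group `N` of automorphisms put
`F_N(r) = ∏ h ∈ N, max (w (h ϖ - ϖ)) r`; a Galois extension `E / M` with group `G` has conductor at
most `m` as soon as `F_G(w (g ϖ - ϖ)) ≥ w ϖ ^ (|G| (m + 1))` for all `g ≠ 1`.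

If `β ^ p ^ j = a` and `n = v_l(t)`, then an explicit uniformizer of `K_l(β)`, a monomial in `β - δ`
(`δ = 0` or `1`) and a uniformizer of `K_l(β ^ p)`, shows that `K_l(β) / K_l(β ^ p)` is totally
ramified of degree `p` with its only ramification jump at `p ^ (l + j - 1) - n`. This gives the
second conductor.

For the first one, let `g ≠ 1` fix `α = a ^ (1 / p ^ c)` and let `N_s` be the stabilizer of
`α ^ p ^ s` in the Galois group of `K_c(α) / K_l`. The jump of the `s`-th layer bounds
`F_{N_{s+1}}` in terms of `F_{N_s}`, both at `w (g ϖ - ϖ)`. If `F_{N_0}` were below the asserted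
bound, this recursion would make `F_{N_c}` too small: `N_c` is the whole Galois group, and since `g`
moves `ζ_{p^c}`, the differences of the conjugates of this root of unity bound `F_{N_c}` from below.
-/

noncomputable section

namespace WildConductor

open Finset Polynomial

/-! ### Absolute values and valuations -/

section AbsVal

variable {A : Type*} [CommRing A] {L : Type*} [Field L] [Algebra A L] {w : AbsoluteValue L ℝ}
  {ϖ : L}

/-- A nonarchimedean absolute value on `L` whose valuation ring is the integral closure of `A`. -/
structure IsIntegralAbs (A : Type*) [CommRing A] {L : Type*} [Field L] [Algebra A L]
    (w : AbsoluteValue L ℝ) : Prop where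
  nonarch : IsNonarchimedean w
  isIntegral_iff : ∀ x, IsIntegral A x ↔ w x ≤ 1

/-- The absolute value `w` is discrete and `ϖ` is a uniformizer for it: the value group is generated
by `w ϖ < 1`. -/
structure IsValueGen (w : AbsoluteValue L ℝ) (ϖ : L) : Prop where
  pos : 0 < w ϖ
  lt_one : w ϖ < 1
  exists_zpow : ∀ x, x ≠ 0 → ∃ n : ℤ, w x = w ϖ ^ n

theorem abs_sub_le_max (hw : IsNonarchimedean w) (x y : L) : w (x - y) ≤ max (w x) (w y) := by
  simpa only [sub_eq_add_neg, w.map_neg] using hw x (-y)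

theorem abs_one_add_of_lt (hw : IsNonarchimedean w) {x : L} (hx : w x < 1) : w (1 + x) = 1 := by
  rw [hw.add_eq_left_of_lt (by rwa [map_one]), map_one]

namespace IsValueGen

theorem ne_zero (hϖ : IsValueGen w ϖ) : ϖ ≠ 0 := w.pos_iff.1 hϖ.pos

theorem zpow_inj (hϖ : IsValueGen w ϖ) {m n : ℤ} : w ϖ ^ m = w ϖ ^ n ↔ m = n :=
  (zpow_right_strictAnti₀ hϖ.pos hϖ.lt_one).injective.eq_iff

theorem le_of_lt_one (hϖ : IsValueGen w ϖ) {x : L} (hx : w x < 1) : w x ≤ w ϖ := by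
  rcases eq_or_ne x 0 with rfl | hx0
  · simp
  obtain ⟨n, hn⟩ := hϖ.exists_zpow x hx0
  have hn0 : 0 < n := by
    by_contra! h
    exact hx.not_ge (hn ▸ one_le_zpow_of_nonpos₀ hϖ.pos hϖ.lt_one.le h)
  rw [hn, ← zpow_one (w ϖ), ← zpow_mul, one_mul]
  exact zpow_le_zpow_right_of_le_one₀ hϖ.pos hϖ.lt_one.le hn0

theorem exists_pow (hϖ : IsValueGen w ϖ) {x : L} (hx0 : x ≠ 0) (hx : w x ≤ 1) :
    ∃ n : ℕ, w x = w ϖ ^ n := by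
  obtain ⟨n, hn⟩ := hϖ.exists_zpow x hx0
  have hn0 : 0 ≤ n := by
    by_contra! h
    exact hx.not_gt (hn ▸ one_lt_zpow_of_neg₀ hϖ.pos hϖ.lt_one h)
  exact ⟨n.toNat, by rw [hn, ← zpow_natCast, Int.toNat_of_nonneg hn0]⟩

end IsValueGen

namespace IsIntegralAbs

variable (hw : IsIntegralAbs A w) (hϖ : IsValueGen w ϖ)
include hw

theorem coe_le_one (x : integralClosure A L) : w (x : L) ≤ 1 := (hw.isIntegral_iff _).1 x.2

/-- The element of the ring of integers with underlying element `x`. -/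
def toInt (x : L) (hx : w x ≤ 1) : integralClosure A L := ⟨x, (hw.isIntegral_iff x).2 hx⟩

theorem coe_toInt {x : L} (hx : w x ≤ 1) : (hw.toInt x hx : L) = x := rfl

theorem isUnit_iff (x : integralClosure A L) : IsUnit x ↔ w (x : L) = 1 := by
  constructor
  · intro hx
    obtain ⟨y, hxy⟩ := hx.exists_right_inv
    have h : w (x : L) * w (y : L) = 1 := by
      rw [← map_mul, ← MulMemClass.coe_mul, hxy, OneMemClass.coe_one, map_one]
    exact le_antisymm (hw.coe_le_one x)
      (h ▸ mul_le_of_le_one_right (w.nonneg _) (hw.coe_le_one y))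
  · intro h
    have hx0 : (x : L) ≠ 0 := w.ne_zero_iff.1 (h ▸ one_ne_zero)
    exact IsUnit.of_mul_eq_one (hw.toInt (x : L)⁻¹ (by rw [map_inv₀, h, inv_one]))
      (Subtype.ext (mul_inv_cancel₀ hx0))

theorem lt_one_of_not_isUnit {x : integralClosure A L} (hx : ¬IsUnit x) : w (x : L) < 1 :=
  (hw.coe_le_one x).lt_of_ne fun h => hx ((hw.isUnit_iff x).2 h)

include hϖ

theorem isUniformizer_iff (x : integralClosure A L) :
    IsUniformizer A L x ↔ w (x : L) = w ϖ := by
  have hϖ0 := hϖ.pos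
  constructor
  · intro hx
    have hle : w ((x : L) / ϖ) ≤ 1 := by
      rw [map_div₀, div_le_one hϖ0]
      exact hϖ.le_of_lt_one (hw.lt_one_of_not_isUnit hx.not_isUnit)
    have hfac : x = hw.toInt ϖ hϖ.lt_one.le * hw.toInt _ hle :=
      Subtype.ext (mul_div_cancel₀ _ hϖ.ne_zero).symm
    rcases hx.isUnit_or_isUnit hfac with h | h
    · exact absurd ((hw.isUnit_iff _).1 h) hϖ.lt_one.ne
    · have h1 : w ((x : L) / ϖ) = 1 := (hw.isUnit_iff _).1 h
      rwa [map_div₀, div_eq_one_iff_eq hϖ0.ne'] at h1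
  · intro hx
    refine ⟨fun hu => hϖ.lt_one.ne (hx.symm.trans ((hw.isUnit_iff _).1 hu)), fun a b hab => ?_⟩
    by_contra! hc
    have hmul : w (a : L) * w (b : L) = w ϖ := by rw [← map_mul, ← hx, hab]; rfl
    have ha := hϖ.le_of_lt_one (hw.lt_one_of_not_isUnit hc.1)
    have hb := hw.lt_one_of_not_isUnit hc.2
    exact (hmul.symm.trans_le (mul_le_mul_of_nonneg_right ha (w.nonneg _))).not_gt
      (mul_lt_of_lt_one_right hϖ0 hb)

theorem hasVal_iff (x : L) (n : ℤ) : HasVal A L x n ↔ w x = w ϖ ^ n := by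
  constructor
  · rintro ⟨π, u, hπ, rfl⟩
    rw [map_mul, map_zpow₀, (hw.isUniformizer_iff hϖ _).1 hπ, (hw.isUnit_iff _).1 u.isUnit,
      mul_one]
  · intro h
    have hu : w (x / ϖ ^ n) = 1 := by
      rw [map_div₀, map_zpow₀, h, div_self (zpow_pos hϖ.pos n).ne']
    have hu' : IsUnit (hw.toInt _ hu.le) := (hw.isUnit_iff _).2 hu
    exact ⟨hw.toInt ϖ hϖ.lt_one.le, hu'.unit, (hw.isUniformizer_iff hϖ _).2 rfl,
      (mul_div_cancel₀ _ (zpow_ne_zero n hϖ.ne_zero)).symm⟩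

theorem val_eq_coe_iff (x : L) (n : ℤ) : val A L x = n ↔ w x = w ϖ ^ n := by
  unfold val
  split_ifs with h
  · rw [WithTop.coe_inj, (hw.hasVal_iff hϖ x _).1 h.choose_spec, hϖ.zpow_inj]
  · simp only [WithTop.top_ne_coe, false_iff]
    exact fun hn => h ⟨n, (hw.hasVal_iff hϖ x n).2 hn⟩

theorem val_zero : val A L (0 : L) = ⊤ := by
  rw [WithTop.eq_top_iff_forall_ne]
  intro n hn
  have h0 := (hw.val_eq_coe_iff hϖ 0 n).1 hn.symm
  rw [map_zero] at h0
  exact (zpow_pos hϖ.pos n).ne h0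

end IsIntegralAbs

end AbsVal

section Monogenic

variable {A : Type*} [CommRing A] {L : Type*} [Field L] [Algebra A L] {w : AbsoluteValue L ℝ}
  {ϖ : L}

/-- The absolute value `w` is discrete with valuation ring the integral closure of `A`, and this
ring is generated over `A` by the uniformizer `ϖ`. -/
structure IsMonogenic (A : Type*) [CommRing A] {L : Type*} [Field L] [Algebra A L]
    (w : AbsoluteValue L ℝ) (ϖ : L) : Prop extends IsIntegralAbs A w, IsValueGen w ϖ where
  exists_aeval : ∀ x, w x ≤ 1 → ∃ P : A[X], aeval ϖ P = x

theorem coe_eval_map (x : integralClosure A L) (P : A[X]) :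
    (((P.map (algebraMap A (integralClosure A L))).eval x : integralClosure A L) : L) =
      aeval (x : L) P := by
  rw [eval_map_algebraMap]
  exact (aeval_algebraMap_apply L x P).symm

theorem IsIntegralAbs.abs_aeval_sub_le (hw : IsIntegralAbs A w) {x y : L} (hx : w x ≤ 1)
    (hy : w y ≤ 1) (P : A[X]) : w (aeval x P - aeval y P) ≤ w (x - y) := by
  obtain ⟨z, hz⟩ := sub_dvd_eval_sub (hw.toInt x hx) (hw.toInt y hy)
    (P.map (algebraMap A (integralClosure A L)))
  have h : aeval x P - aeval y P = (x - y) * z := by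
    have hz' := congrArg Subtype.val hz
    simpa only [AddSubgroupClass.coe_sub, MulMemClass.coe_mul, coe_eval_map, coe_toInt] using hz'
  rw [h, map_mul]
  exact mul_le_of_le_one_right (w.nonneg _) (hw.coe_le_one z)

variable {M : Type*} [Field M] [Algebra A M] [Algebra M L] [IsScalarTower A M L]

theorem algEquiv_aeval (g : L ≃ₐ[M] L) (P : A[X]) (x : L) : g (aeval x P) = aeval (g x) P :=
  (aeval_algHom_apply ((g : L →ₐ[M] L).restrictScalars A) x P).symm

namespace IsIntegralAbs

variable (hw : IsIntegralAbs A w) (hϖ : IsValueGen w ϖ)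
include hw

theorem map_le_one_iff (g : L ≃ₐ[M] L) (x : L) : w (g x) ≤ 1 ↔ w x ≤ 1 := by
  rw [← hw.isIntegral_iff, ← hw.isIntegral_iff]
  exact isIntegral_algEquiv (g.restrictScalars A)

theorem map_le_map_iff (g : L ≃ₐ[M] L) {x y : L} (hy : y ≠ 0) : w (g x) ≤ w (g y) ↔ w x ≤ w y := by
  have := hw.map_le_one_iff g (x / y)
  rwa [map_div₀, map_div₀, map_div₀, div_le_one (w.pos hy),
    div_le_one (w.pos ((map_ne_zero g).2 hy))] at this

include hϖ

theorem map_uniformizer (g : L ≃ₐ[M] L) : w (g ϖ) = w ϖ := by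
  have hle : ∀ g : L ≃ₐ[M] L, w (g ϖ) ≤ w ϖ := fun g => by
    refine hϖ.le_of_lt_one (lt_of_not_ge fun h => hϖ.lt_one.not_ge ?_)
    have h1 := hw.map_le_map_iff g (x := 1) hϖ.ne_zero
    simpa using h1.1 (by simpa using h)
  refine le_antisymm (hle g) ?_
  rw [← hw.map_le_map_iff g⁻¹ ((map_ne_zero g).2 hϖ.ne_zero)]
  simpa using hle g⁻¹

theorem map_eq (g : L ≃ₐ[M] L) (x : L) : w (g x) = w x := by
  rcases eq_or_ne x 0 with rfl | hx
  · rw [map_zero]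
  obtain ⟨n, hn⟩ := hϖ.exists_zpow x hx
  have hpow : w (ϖ ^ n) = w x := by rw [map_zpow₀, hn]
  have hpow0 : ϖ ^ n ≠ 0 := zpow_ne_zero n hϖ.ne_zero
  have hg : w (g (ϖ ^ n)) = w x := by rw [map_zpow₀, map_zpow₀, hw.map_uniformizer hϖ, hn]
  exact le_antisymm (((hw.map_le_map_iff g hpow0).2 hpow.ge).trans hg.le)
    (hg.ge.trans ((hw.map_le_map_iff g hx).2 hpow.le))

theorem abs_map_sub_le_self (g : L ≃ₐ[M] L) (x : L) : w (g x - x) ≤ w x := by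
  simpa only [hw.map_eq hϖ, max_self] using abs_sub_le_max hw.nonarch (g x) x

theorem abs_inv_map_sub (g : L ≃ₐ[M] L) (x : L) : w (g⁻¹ x - x) = w (g x - x) := by
  rw [← hw.map_eq hϖ g, map_sub, ← AlgEquiv.mul_apply, mul_inv_cancel, AlgEquiv.one_apply,
    w.map_sub]

theorem abs_mul_map_sub_le (g h : L ≃ₐ[M] L) (x : L) :
    w ((g * h) x - x) ≤ max (w (g x - x)) (w (h x - x)) := by
  have hsplit : (g * h) x - x = (g x - x) + g (h x - x) := by
    rw [map_sub, AlgEquiv.mul_apply]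
    ring
  rw [hsplit, ← hw.map_eq hϖ g (h x - x)]
  exact hw.nonarch _ _

end IsIntegralAbs

namespace IsMonogenic

variable (hϖ : IsMonogenic A w ϖ)
include hϖ

theorem abs_map_sub_le (g : L ≃ₐ[M] L) {x : L} (hx : w x ≤ 1) : w (g x - x) ≤ w (g ϖ - ϖ) := by
  obtain ⟨P, rfl⟩ := hϖ.exists_aeval x hx
  rw [algEquiv_aeval]
  exact hϖ.abs_aeval_sub_le (by rw [hϖ.map_eq hϖ.toIsValueGen]; exact hϖ.lt_one.le) hϖ.lt_one.le P

theorem eq_one_of_map_eq {g : L ≃ₐ[M] L} (hg : g ϖ = ϖ) : g = 1 := by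
  have hint : ∀ x, w x ≤ 1 → g x = x := fun x hx => by
    have h := hϖ.abs_map_sub_le g hx
    rw [hg, sub_self, map_zero] at h
    exact sub_eq_zero.1 (w.eq_zero.1 (h.antisymm (w.nonneg _)))
  ext x
  rcases le_total (w x) 1 with hx | hx
  · exact hint x hx
  · have hinv := hint x⁻¹ (by rw [map_inv₀]; exact inv_le_one_of_one_le₀ hx)
    rwa [map_inv₀, inv_inj] at hinv

theorem abs_map_sub_pos {g : L ≃ₐ[M] L} (hg : g ≠ 1) : 0 < w (g ϖ - ϖ) :=
  w.pos (sub_ne_zero.2 fun h => hg (hϖ.eq_one_of_map_eq h))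

theorem abs_map_sub_eq (g : L ≃ₐ[M] L) {π : L} (hπ : w π = w ϖ) :
    w (g π - π) = w (g ϖ - ϖ) := by
  rcases eq_or_ne g 1 with rfl | hg
  · simp
  have hu : w (π / ϖ) = 1 := by rw [map_div₀, hπ, div_self hϖ.pos.ne']
  have hsplit : g π - π = g ϖ * (g (π / ϖ) - π / ϖ) + π / ϖ * (g ϖ - ϖ) := by
    have hg0 : g ϖ ≠ 0 := (map_ne_zero g).2 hϖ.ne_zero
    have hϖ0 := hϖ.ne_zero
    rw [map_div₀]
    field_simp
    ring
  have hlt : w (g ϖ * (g (π / ϖ) - π / ϖ)) < w (π / ϖ * (g ϖ - ϖ)) := by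
    rw [map_mul, map_mul, hu, hϖ.map_eq hϖ.toIsValueGen, one_mul]
    calc w ϖ * w (g (π / ϖ) - π / ϖ) ≤ w ϖ * w (g ϖ - ϖ) :=
          mul_le_mul_of_nonneg_left (hϖ.abs_map_sub_le g hu.le) (w.nonneg _)
      _ < w (g ϖ - ϖ) := mul_lt_of_lt_one_left (hϖ.abs_map_sub_pos hg) hϖ.lt_one
  rw [hsplit, hϖ.nonarch.add_eq_right_of_lt hlt, map_mul, hu, one_mul]

end IsMonogenic

end Monogenic

/-! ### The Herbrand function and the conductor -/

section Conductor

theorem integral_ite_le {a u : ℝ} (ha : 0 ≤ a) (hu : 0 ≤ u) :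
    ∫ t in (0 : ℝ)..u, (if t ≤ a then (1 : ℝ) else 0) = min u a := by
  rcases le_total a u with h | h
  · have := intervalIntegral.integral_indicator (μ := MeasureTheory.volume)
      (f := fun _ : ℝ => (1 : ℝ)) (a₁ := 0) (a₂ := a) (a₃ := u) ⟨ha, h⟩
    simpa [Set.indicator, h] using this
  · rw [intervalIntegral.integral_congr (g := fun _ => (1 : ℝ))]
    · simp [h]
    · intro t ht
      rw [Set.uIcc_of_le hu] at ht
      exact if_pos (ht.2.trans h)

theorem intervalIntegrable_ite_le (a u v : ℝ) :
    IntervalIntegrable (fun t : ℝ => if t ≤ a then (1 : ℝ) else 0) MeasureTheory.volume u v := by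
  refine Antitone.intervalIntegrable fun x y hxy => ?_
  split_ifs with hy hx
  exacts [le_rfl, absurd (hxy.trans hy) hx, zero_le_one, le_rfl]

variable {A : Type*} [CommRing A] {L : Type*} [Field L] [Algebra A L]
  {M : Type*} [Field M] [Algebra M L] {w : AbsoluteValue L ℝ} {ϖ : L}

/-- For `g ≠ 1`, the natural number `i g` is the largest `i` with `g ∈ G_i`. Nothing is required of
`i 1`. -/
def IsRamIndex (w : AbsoluteValue L ℝ) (ϖ : L) (i : (L ≃ₐ[M] L) → ℕ) : Prop :=
  ∀ g, g ≠ 1 → w (g ϖ - ϖ) = w ϖ ^ (i g + 1)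

variable (M) in
theorem one_mem_lowerRam (hw : IsIntegralAbs A w) (hϖ : IsValueGen w ϖ) (t : ℝ) :
    (1 : L ≃ₐ[M] L) ∈ lowerRam A L M t := fun π _ => by
  simp [hw.val_zero hϖ]

variable {i : (L ≃ₐ[M] L) → ℕ}

theorem prod_max_eq_pow [Fintype (L ≃ₐ[M] L)] [DecidableEq (L ≃ₐ[M] L)] (hϖ : IsValueGen w ϖ)
    (hi : IsRamIndex w ϖ i) {g : L ≃ₐ[M] L} (hg : g ≠ 1) :
    ∏ h : L ≃ₐ[M] L, max (w (h ϖ - ϖ)) (w (g ϖ - ϖ)) =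
      w ϖ ^ (i g + ∑ h ∈ univ.erase (1 : L ≃ₐ[M] L), min (i g) (i h) +
        Fintype.card (L ≃ₐ[M] L)) := by
  have hanti : Antitone fun n : ℕ => w ϖ ^ n := pow_right_anti₀ hϖ.pos.le hϖ.lt_one.le
  have hmax : ∀ h ∈ univ.erase (1 : L ≃ₐ[M] L), max (w (h ϖ - ϖ)) (w (g ϖ - ϖ)) =
      w ϖ ^ (min (i g) (i h) + 1) := fun h hh => by
    rw [hi g hg, hi h (ne_of_mem_erase hh), max_comm, ← hanti.map_min, min_add_add_right]
  have hone : max (w ((1 : L ≃ₐ[M] L) ϖ - ϖ)) (w (g ϖ - ϖ)) = w ϖ ^ (i g + 1) := by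
    simp [hi g hg]
  rw [← mul_prod_erase univ _ (mem_univ 1), hone, prod_congr rfl hmax, prod_pow_eq_pow_sum,
    ← pow_add, sum_add_distrib, ← card_eq_sum_ones]
  have := card_erase_add_one (mem_univ (1 : L ≃ₐ[M] L))
  rw [card_univ] at this
  congr 1
  lia

variable [Algebra A M] [IsScalarTower A M L] (hϖ : IsMonogenic A w ϖ)
include hϖ

variable (M) in
theorem IsMonogenic.exists_isRamIndex : ∃ i : (L ≃ₐ[M] L) → ℕ, IsRamIndex w ϖ i := by
  have hex : ∀ g : L ≃ₐ[M] L, ∃ n : ℕ, g ≠ 1 → w (g ϖ - ϖ) = w ϖ ^ (n + 1) := fun g => by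
    by_cases hg : g = 1
    · exact ⟨0, fun h => absurd hg h⟩
    have hle := hϖ.abs_map_sub_le_self hϖ.toIsValueGen g ϖ
    obtain ⟨n, hn⟩ := hϖ.exists_pow (w.pos_iff.1 (hϖ.abs_map_sub_pos hg))
      (hle.trans hϖ.lt_one.le)
    have hn0 : n ≠ 0 := by
      rintro rfl
      exact (hn ▸ hle).not_gt (by simpa using hϖ.lt_one)
    exact ⟨n - 1, fun _ => by rwa [Nat.sub_add_cancel (Nat.pos_of_ne_zero hn0)]⟩
  choose i hi using hex
  exact ⟨i, hi⟩

theorem mem_lowerRam_iff (hi : IsRamIndex w ϖ i) {t : ℝ} {g : L ≃ₐ[M] L} (hg : g ≠ 1) :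
    g ∈ lowerRam A L M t ↔ t ≤ i g := by
  have hval : ∀ π : L, w π = w ϖ → (((t + 1 : ℝ) : WithTop ℝ) ≤
      (val A L (g π - π)).map (fun n : ℤ => (n : ℝ)) ↔ t ≤ i g) := fun π hπ => by
    rw [(hϖ.val_eq_coe_iff hϖ.toIsValueGen _ ((i g + 1 : ℕ) : ℤ)).2
      (by rw [hϖ.abs_map_sub_eq g hπ, hi g hg, zpow_natCast]), WithTop.map_coe, WithTop.coe_le_coe]
    push_cast
    exact add_le_add_iff_right 1
  constructor
  · intro h
    exact (hval ϖ rfl).1 (h (hϖ.toInt ϖ hϖ.lt_one.le)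
      ((hϖ.isUniformizer_iff hϖ.toIsValueGen _).2 rfl))
  · intro h π hπ
    exact (hval π ((hϖ.isUniformizer_iff hϖ.toIsValueGen _).1 hπ)).2 h

theorem ncard_lowerRam [Fintype (L ≃ₐ[M] L)] [DecidableEq (L ≃ₐ[M] L)] (hi : IsRamIndex w ϖ i)
    (t : ℝ) : ((lowerRam A L M t).ncard : ℝ) =
      1 + ∑ g ∈ univ.erase (1 : L ≃ₐ[M] L), if t ≤ i g then (1 : ℝ) else 0 := by
  have hset : lowerRam A L M t = ↑(insert 1 ((univ.erase 1).filter fun g => t ≤ i g)) := by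
    ext g
    by_cases hg : g = 1
    · simp [hg, one_mem_lowerRam M hϖ.toIsIntegralAbs hϖ.toIsValueGen t]
    · simp [hg, mem_lowerRam_iff hϖ hi hg]
  rw [hset, Set.ncard_coe_finset, card_insert_of_notMem (by simp), sum_boole, Nat.cast_add,
    Nat.cast_one, add_comm]

theorem phi_eq [Fintype (L ≃ₐ[M] L)] [DecidableEq (L ≃ₐ[M] L)] (hi : IsRamIndex w ϖ i) {u : ℝ}
    (hu : 0 ≤ u) : phi A L M u =
      (u + ∑ g ∈ univ.erase (1 : L ≃ₐ[M] L), min u (i g)) / Fintype.card (L ≃ₐ[M] L) := by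
  have hcard : ((lowerRam A L M 0).ncard : ℝ) = Fintype.card (L ≃ₐ[M] L) := by
    simp only [ncard_lowerRam hϖ hi, Nat.cast_nonneg, if_true, sum_const, nsmul_eq_mul, mul_one]
    rw [card_erase_of_mem (mem_univ _), card_univ, Nat.cast_sub Fintype.card_pos]
    simp
  have hint : ∀ g ∈ univ.erase (1 : L ≃ₐ[M] L), IntervalIntegrable
      (fun t : ℝ => if t ≤ i g then (1 : ℝ) else 0) MeasureTheory.volume 0 u :=
    fun g _ => intervalIntegrable_ite_le _ _ _
  have hsum := IntervalIntegrable.sum _ hint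
  simp only [sum_fn] at hsum
  unfold phi
  simp only [intervalIntegral.integral_div, hcard, ncard_lowerRam hϖ hi]
  rw [intervalIntegral.integral_add (by simp) hsum, intervalIntegral.integral_finsetSum hint]
  simp [integral_ite_le (Nat.cast_nonneg _) hu]

variable (A M) in
theorem phi_strictMonoOn [Finite (L ≃ₐ[M] L)] : StrictMonoOn (phi A L M) (Set.Ici 0) := by
  classical
  cases nonempty_fintype (L ≃ₐ[M] L)
  obtain ⟨i, hi⟩ := hϖ.exists_isRamIndex M
  intro u hu v hv huv
  rw [phi_eq hϖ hi hu, phi_eq hϖ hi hv]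
  exact div_lt_div_of_pos_right (add_lt_add_of_lt_of_le huv
    (sum_le_sum fun g _ => min_le_min_right _ huv.le)) (by exact_mod_cast Fintype.card_pos)

variable (A M) in
theorem phi_surjOn [Finite (L ≃ₐ[M] L)] : Set.SurjOn (phi A L M) (Set.Ici 0) (Set.Ici 0) := by
  classical
  cases nonempty_fintype (L ≃ₐ[M] L)
  obtain ⟨i, hi⟩ := hϖ.exists_isRamIndex M
  intro x hx
  have hc : (0 : ℝ) < Fintype.card (L ≃ₐ[M] L) := by exact_mod_cast Fintype.card_pos
  have hb : 0 ≤ x * Fintype.card (L ≃ₐ[M] L) := mul_nonneg hx hc.le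
  have hcont : ContinuousOn (phi A L M) (Set.Icc 0 (x * Fintype.card (L ≃ₐ[M] L))) := by
    refine ContinuousOn.congr (Continuous.continuousOn ?_) fun u hu => phi_eq hϖ hi hu.1
    fun_prop
  have hlow : phi A L M 0 ≤ x := by simpa [phi] using hx
  have hhigh : x ≤ phi A L M (x * Fintype.card (L ≃ₐ[M] L)) := by
    rw [phi_eq hϖ hi hb, le_div_iff₀ hc]
    exact le_add_of_nonneg_right (sum_nonneg fun g _ => le_min hb (Nat.cast_nonneg _))
  obtain ⟨u, hu, hux⟩ := intermediate_value_Icc hb hcont ⟨hlow, hhigh⟩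
  exact ⟨u, hu.1, hux⟩

theorem upperRam_ne_iff [Finite (L ≃ₐ[M] L)] (hi : IsRamIndex w ϖ i) {x : ℝ} (hx : 0 ≤ x) :
    upperRam A L M x ≠ {1} ↔ ∃ g : L ≃ₐ[M] L, g ≠ 1 ∧ x ≤ phi A L M (i g) := by
  have hψ0 : 0 ≤ psi A L M x := Function.invFunOn_mem (phi_surjOn A M hϖ hx)
  have hφψ : phi A L M (psi A L M x) = x := Function.invFunOn_eq (phi_surjOn A M hϖ hx)
  have hmem : ∀ g : L ≃ₐ[M] L, g ≠ 1 → (g ∈ upperRam A L M x ↔ x ≤ phi A L M (i g)) := by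
    intro g hg
    rw [upperRam, mem_lowerRam_iff hϖ hi hg,
      ← (phi_strictMonoOn A M hϖ).le_iff_le hψ0 (Set.mem_Ici.2 (Nat.cast_nonneg _)), hφψ]
  rw [Ne, Set.eq_singleton_iff_unique_mem, not_and]
  push Not
  constructor
  · intro h
    obtain ⟨g, hg, hg1⟩ := h (one_mem_lowerRam M hϖ.toIsIntegralAbs hϖ.toIsValueGen _)
    exact ⟨g, hg1, (hmem g hg1).1 hg⟩
  · rintro ⟨g, hg1, hg⟩ -
    exact ⟨g, (hmem g hg1).2 hg, hg1⟩

theorem phi_ramIndex_le [Fintype (L ≃ₐ[M] L)] (hi : IsRamIndex w ϖ i) {m : ℕ} {g : L ≃ₐ[M] L}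
    (hg : g ≠ 1) (hbd : w ϖ ^ (Fintype.card (L ≃ₐ[M] L) * (m + 1)) ≤
      ∏ h : L ≃ₐ[M] L, max (w (h ϖ - ϖ)) (w (g ϖ - ϖ))) : phi A L M (i g) ≤ m := by
  classical
  rw [prod_max_eq_pow hϖ.toIsValueGen hi hg, pow_le_pow_iff_right_of_lt_one₀ hϖ.pos hϖ.lt_one,
    mul_add_one, add_le_add_iff_right, mul_comm] at hbd
  rw [phi_eq hϖ hi (Nat.cast_nonneg _), div_le_iff₀ (by exact_mod_cast Fintype.card_pos)]
  exact_mod_cast hbd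

variable (M) in
theorem ramConductor_le [Fintype (L ≃ₐ[M] L)] {m : ℕ}
    (hbd : ∀ g : L ≃ₐ[M] L, g ≠ 1 → w ϖ ^ (Fintype.card (L ≃ₐ[M] L) * (m + 1)) ≤
      ∏ h : L ≃ₐ[M] L, max (w (h ϖ - ϖ)) (w (g ϖ - ϖ))) :
    ramConductor A L M ≤ m := by
  obtain ⟨i, hi⟩ := hϖ.exists_isRamIndex M
  refine Real.sSup_le (fun x hx => ?_) m.cast_nonneg
  obtain ⟨g, hg, hxg⟩ := (upperRam_ne_iff hϖ hi hx.1).1 hx.2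
  exact hxg.trans (phi_ramIndex_le hϖ hi hg (hbd g hg))

variable (M) in
theorem ramConductor_eq [Finite (L ≃ₐ[M] L)] [Nontrivial (L ≃ₐ[M] L)] {m : ℕ}
    (heq : ∀ g : L ≃ₐ[M] L, g ≠ 1 → w (g ϖ - ϖ) = w ϖ ^ (m + 1)) : ramConductor A L M = m := by
  classical
  cases nonempty_fintype (L ≃ₐ[M] L)
  have hi : IsRamIndex w ϖ fun _ : L ≃ₐ[M] L => m := heq
  have hm0 : (0 : ℝ) ≤ m := m.cast_nonneg
  have hφ : phi A L M m = m := by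
    have hcard := card_erase_add_one (mem_univ (1 : L ≃ₐ[M] L))
    have hc : (Fintype.card (L ≃ₐ[M] L) : ℝ) ≠ 0 := by exact_mod_cast Fintype.card_ne_zero
    rw [phi_eq hϖ hi hm0, div_eq_iff hc, ← card_univ, ← hcard]
    simp
    ring
  obtain ⟨g, hg⟩ := exists_ne (1 : L ≃ₐ[M] L)
  refine IsGreatest.csSup_eq ⟨⟨hm0, (upperRam_ne_iff hϖ hi hm0).2 ⟨g, hg, hφ.ge⟩⟩, fun x hx => ?_⟩
  obtain ⟨h, -, hxh⟩ := (upperRam_ne_iff hϖ hi hx.1).1 hx.2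
  exact hxh.trans hφ.le

end Conductor

/-! ### Herbrand products of subgroups -/

section Products

theorem prod_le_prod_comp_of_injective {α β R : Type*} [Fintype α] [Fintype β]
    [CommSemiring R] [PartialOrder R] [IsOrderedRing R] {f : β → R} (h0 : ∀ b, 0 ≤ f b)
    (h1 : ∀ b, f b ≤ 1) {φ : α → β} (hφ : Function.Injective φ) :
    ∏ b, f b ≤ ∏ a, f (φ a) := by
  classical
  rw [← prod_image hφ.injOn, ← prod_sdiff (subset_univ (univ.image φ))]
  exact mul_le_of_le_one_left (prod_nonneg fun b _ => h0 b)
    (prod_le_one (fun b _ => h0 b) fun b _ => h1 b)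

theorem injective_pow_mul {G : Type*} [Group G] {N : Subgroup G} {σ : G} {p : ℕ}
    (hσ : ∀ i, 0 < i → i < p → σ ^ i ∉ N) :
    Function.Injective fun x : Fin p × N => σ ^ (x.1 : ℕ) * (x.2 : G) := by
  have key : ∀ i j : ℕ, j < p → i < j → ∀ g h : N, σ ^ i * (g : G) ≠ σ ^ j * (h : G) := by
    intro i j hj hij g h hgh
    refine hσ (j - i) (by lia) (by lia) ?_
    have : σ ^ (j - i) = (g : G) * (h : G)⁻¹ := by
      rw [eq_mul_inv_iff_mul_eq, ← mul_right_inj (σ ^ i), hgh, ← mul_assoc, ← pow_add,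
        Nat.add_sub_cancel' hij.le]
    exact this ▸ mul_mem g.2 (inv_mem h.2)
  rintro ⟨i, g⟩ ⟨j, h⟩ (hij : σ ^ (i : ℕ) * (g : G) = σ ^ (j : ℕ) * (h : G))
  obtain rfl : i = j := by
    by_contra hne
    rcases Ne.lt_or_gt hne with hlt | hlt
    exacts [key i j j.2 hlt g h hij, key j i i.2 hlt h g hij.symm]
  exact Prod.ext rfl (Subtype.ext (mul_left_cancel hij))

open MulAction in
theorem prod_filter_smul_eq {G α R : Type*} [Group G] [Fintype G] [MulAction G α] [DecidableEq α]
    [CommMonoid R] (s : G) (y : α) [Fintype (stabilizer G y)] (F : G → R) :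
    ∏ h with h • y = s • y, F h = ∏ h : stabilizer G y, F (s * h) := by
  refine (prod_bij (fun (h : stabilizer G y) _ => s * (h : G)) (fun h _ => ?_)
    (fun _ _ _ _ hab => ?_) (fun h hh => ?_) fun _ _ => rfl).symm
  · rw [mem_filter, mul_smul, mem_stabilizer_iff.1 h.2]
    exact ⟨mem_univ _, rfl⟩
  · exact Subtype.ext (mul_left_cancel hab)
  · refine ⟨⟨s⁻¹ * h, ?_⟩, mem_univ _, mul_inv_cancel_left s h⟩
    rw [mem_stabilizer_iff, mul_smul, (mem_filter.1 hh).2, inv_smul_smul]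

theorem prod_sub_dvd_eval {ι R : Type*} [Fintype ι] [CommRing R] [IsDomain R] {v : ι → R}
    (hv : Function.Injective v) {P : R[X]} (hP : ∀ i, P.eval (v i) = 0) (x : R) :
    ∏ i, (x - v i) ∣ P.eval x := by
  rcases eq_or_ne P 0 with rfl | h0
  · simp
  have hdvd : ((univ.val.map v).map fun a => X - C a).prod ∣ P := by
    rw [Multiset.prod_X_sub_C_dvd_iff_le_roots h0, Multiset.le_iff_subset (univ.nodup.map hv)]
    intro t ht
    obtain ⟨i, -, rfl⟩ := Multiset.mem_map.1 ht
    exact (mem_roots h0).2 (hP i)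
  rw [Multiset.map_map] at hdvd
  have heval : (∏ i, (X - C (v i))).eval x ∣ P.eval x := eval_dvd hdvd
  simpa only [eval_prod, eval_sub, eval_X, eval_C] using heval

theorem abs_eval_le {L : Type*} [Field L] {w : AbsoluteValue L ℝ} (hw : IsNonarchimedean w) {x : L}
    (hx : w x ≤ 1) {P : L[X]} {b : ℝ} (hP : ∀ i, w (P.coeff i) ≤ b) : w (P.eval x) ≤ b := by
  rw [eval_eq_sum_range]
  refine (hw.apply_sum_le_sup ⟨0, mem_range.2 (Nat.succ_pos _)⟩).trans (sup'_le _ _ fun i _ => ?_)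
  rw [map_mul, map_pow]
  exact (mul_le_of_le_one_right (w.nonneg _) (pow_le_one₀ (w.nonneg _) hx)).trans (hP i)

end Products

section Cosets

variable {A : Type*} [CommRing A] {L : Type*} [Field L] [Algebra A L] {M : Type*} [Field M]
  [Algebra A M] [Algebra M L] [IsScalarTower A M L] {w : AbsoluteValue L ℝ} {ϖ : L}

theorem IsIntegralAbs.abs_le_of_dvd (hw : IsIntegralAbs A w) {x y : integralClosure A L}
    (h : x ∣ y) : w (y : L) ≤ w (x : L) := by
  obtain ⟨z, rfl⟩ := h
  rw [MulMemClass.coe_mul, map_mul]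
  exact mul_le_of_le_one_right (w.nonneg _) (hw.coe_le_one z)

open MulSemiringAction in
theorem IsIntegralAbs.abs_coeff_charpoly_le_one (hw : IsIntegralAbs A w)
    (N : Subgroup (L ≃ₐ[M] L)) [Fintype N] {x : L} (hx : w x ≤ 1) (i : ℕ) :
    w ((charpoly N x).coeff i) ≤ 1 := by
  have hmem : charpoly N x ∈ lifts (algebraMap (integralClosure A L) L) := by
    rw [charpoly_eq]
    refine prod_mem fun h _ => ?_
    refine ⟨X - C (hw.toInt ((h : L ≃ₐ[M] L) x) ((hw.map_le_one_iff _ x).2 hx)), ?_⟩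
    simp only [coe_mapRingHom, Polynomial.map_sub, map_X, map_C]
    rfl
  obtain ⟨c, hc⟩ := (lifts_iff_coeff_lifts _).1 hmem i
  rw [← hc]
  exact hw.coe_le_one c

section ValueGen

variable (hw : IsIntegralAbs A w) (hϖ : IsValueGen w ϖ)
include hw hϖ

/- The minimum of `g ↦ w (g ϖ - ϖ)` on the coset `s N` is attained, at `s n` say; the ultrametric
inequality then determines the values on the whole coset. -/
theorem exists_coset_min (N : Subgroup (L ≃ₐ[M] L)) [Finite N] (s : L ≃ₐ[M] L) :
    ∃ n ∈ N, ∀ h ∈ N, w ((s * n * h) ϖ - ϖ) = max (w ((s * n) ϖ - ϖ)) (w (h ϖ - ϖ)) := by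
  obtain ⟨n, hn⟩ := Finite.exists_min fun n : N => w ((s * (n : L ≃ₐ[M] L)) ϖ - ϖ)
  refine ⟨n, n.2, fun h hh => le_antisymm (hw.abs_mul_map_sub_le hϖ _ _ _) ?_⟩
  have hle : w ((s * n) ϖ - ϖ) ≤ w ((s * n * h) ϖ - ϖ) := by
    simpa only [Subgroup.coe_mul, mul_assoc] using hn (n * ⟨h, hh⟩)
  refine max_le hle ?_
  have h2 := hw.abs_mul_map_sub_le hϖ (s * (n : L ≃ₐ[M] L))⁻¹ (s * n * h) ϖ
  rw [inv_mul_cancel_left, hw.abs_inv_map_sub hϖ] at h2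
  exact h2.trans (max_le hle le_rfl)

open MulSemiringAction in
theorem prod_coset_le (N : Subgroup (L ≃ₐ[M] L)) [Fintype N] (s : L ≃ₐ[M] L) {b : ℝ}
    (hb : ∀ x, (∀ h ∈ N, h x = x) → w x ≤ 1 → w (s x - x) ≤ b) :
    ∏ h : N, w ((s * (h : L ≃ₐ[M] L)) ϖ - ϖ) ≤ b := by
  set f : L[X] := charpoly N ϖ with hf
  have hprod : ((f.map (s : L →+* L)) - f).eval ϖ = ∏ h : N, (ϖ - (s * (h : L ≃ₐ[M] L)) ϖ) := by
    rw [eval_sub, eval_charpoly, sub_zero, hf, charpoly_eq, Polynomial.map_prod, eval_prod]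
    simp [Subgroup.smul_def]
  calc ∏ h : N, w ((s * (h : L ≃ₐ[M] L)) ϖ - ϖ) = w (((f.map (s : L →+* L)) - f).eval ϖ) := by
        rw [hprod, map_prod]
        exact prod_congr rfl fun h _ => w.map_sub _ _
    _ ≤ b := abs_eval_le hw.nonarch hϖ.lt_one.le fun i => by
        rw [coeff_sub, coeff_map]
        exact hb _ (fun h hh => smul_coeff_charpoly ϖ i (⟨h, hh⟩ : N))
          (hw.abs_coeff_charpoly_le_one N hϖ.lt_one.le i)

end ValueGen

theorem IsMonogenic.le_prod_coset (hϖ : IsMonogenic A w ϖ) (N : Subgroup (L ≃ₐ[M] L)) [Fintype N]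
    (s : L ≃ₐ[M] L) {y : L} (hy : ∀ h ∈ N, h y = y) (hy1 : w y ≤ 1) :
    w (s y - y) ≤ ∏ h : N, w ((s * (h : L ≃ₐ[M] L)) ϖ - ϖ) := by
  have hle : ∀ g : L ≃ₐ[M] L, w (g ϖ) ≤ 1 := fun g =>
    (hϖ.map_le_one_iff g ϖ).2 hϖ.lt_one.le
  obtain ⟨P, hP⟩ := hϖ.exists_aeval y hy1
  let v : N → integralClosure A L := fun h => hϖ.toInt ((h : L ≃ₐ[M] L) ϖ) (hle _)
  have hv : Function.Injective v := fun a b hab => by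
    have hab' : (a : L ≃ₐ[M] L) ϖ = (b : L ≃ₐ[M] L) ϖ := congrArg Subtype.val hab
    refine Subtype.ext (inv_mul_eq_one.1 (hϖ.eq_one_of_map_eq ?_))
    rw [AlgEquiv.mul_apply, ← hab', ← AlgEquiv.mul_apply, inv_mul_cancel, AlgEquiv.one_apply]
  let R : (integralClosure A L)[X] :=
    P.map (algebraMap A (integralClosure A L)) - C (hϖ.toInt y hy1)
  have hR : ∀ g : L ≃ₐ[M] L, ((R.eval (hϖ.toInt (g ϖ) (hle g)) : integralClosure A L) : L) =
      g y - y := fun g => by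
    rw [eval_sub, eval_C, AddSubgroupClass.coe_sub, coe_eval_map, hϖ.coe_toInt, hϖ.coe_toInt,
      ← algEquiv_aeval, hP]
  have hroot : ∀ h, R.eval (v h) = 0 := fun h => Subtype.ext <| by
    rw [hR, hy _ h.2, sub_self, ZeroMemClass.coe_zero]
  have hdvd := hϖ.abs_le_of_dvd (prod_sub_dvd_eval hv hroot (hϖ.toInt (s⁻¹ ϖ) (hle _)))
  rw [hR, hϖ.abs_inv_map_sub hϖ.toIsValueGen] at hdvd
  refine hdvd.trans_eq ?_
  rw [SubmonoidClass.coe_finsetProd, map_prod]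
  refine prod_congr rfl fun h _ => ?_
  rw [← hϖ.map_eq hϖ.toIsValueGen s, AddSubgroupClass.coe_sub, map_sub, hϖ.coe_toInt,
    ← AlgEquiv.mul_apply, mul_inv_cancel, w.map_sub]
  rfl

end Cosets

section RamProd

variable {A : Type*} [CommRing A] {L : Type*} [Field L] [Algebra A L] {M : Type*} [Field M]
  [Algebra M L] {w : AbsoluteValue L ℝ} {ϖ : L}

/-- The Herbrand function of a subgroup `N` in multiplicative form: if `r = w ϖ ^ (u + 1)`, its
value is `w ϖ ^ (|N| (φ_N(u) + 1))`. -/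
def ramProd (w : AbsoluteValue L ℝ) (ϖ : L) (N : Subgroup (L ≃ₐ[M] L)) [Fintype N] (r : ℝ) : ℝ :=
  ∏ h : N, max (w ((h : L ≃ₐ[M] L) ϖ - ϖ)) r

theorem ramProd_of_eq_top [Fintype (L ≃ₐ[M] L)] {N : Subgroup (L ≃ₐ[M] L)} [Fintype N]
    (hN : N = ⊤) (r : ℝ) : ramProd w ϖ N r = ∏ h : L ≃ₐ[M] L, max (w (h ϖ - ϖ)) r := by
  subst hN
  exact Fintype.prod_equiv Subgroup.topEquiv.toEquiv _ _ fun _ => rfl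

theorem ramProd_nonneg (N : Subgroup (L ≃ₐ[M] L)) [Fintype N] (r : ℝ) : 0 ≤ ramProd w ϖ N r :=
  prod_nonneg fun _ _ => (w.nonneg _).trans (le_max_left _ _)

variable [Algebra A M] [IsScalarTower A M L]

section ValueGen

variable (hw : IsIntegralAbs A w) (hϖ : IsValueGen w ϖ)
include hw hϖ

theorem prod_coset_max_le (N : Subgroup (L ≃ₐ[M] L)) [Fintype N] (s : L ≃ₐ[M] L) {b : ℝ}
    (hb : ∏ h : N, w ((s * (h : L ≃ₐ[M] L)) ϖ - ϖ) ≤ b) (r : ℝ) :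
    ∏ h : N, max (w ((s * (h : L ≃ₐ[M] L)) ϖ - ϖ)) r ≤ max b (ramProd w ϖ N r) := by
  obtain ⟨n, hn, hmin⟩ := exists_coset_min hw hϖ N s
  have htranslate : ∀ F : (L ≃ₐ[M] L) → ℝ, ∏ h : N, F (s * h) = ∏ h : N, F (s * n * h) :=
    fun F => (Fintype.prod_equiv (Equiv.mulLeft (⟨n, hn⟩ : N)) _ _ fun h => by
      simp [mul_assoc]).symm
  rw [htranslate fun g => w (g ϖ - ϖ)] at hb
  rw [htranslate fun g => max (w (g ϖ - ϖ)) r]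
  rcases le_total (w ((s * n) ϖ - ϖ)) r with h | h
  · refine le_trans (prod_congr rfl fun h' _ => ?_).le (le_max_right _ _)
    rw [hmin _ h'.2, max_comm (w ((s * n) ϖ - ϖ)), max_assoc, max_eq_right h]
  · refine le_trans (prod_congr rfl fun h' _ => ?_).le (hb.trans (le_max_left _ _))
    rw [hmin _ h'.2]
    exact max_eq_left (h.trans (le_max_left _ _))

theorem abs_pow_map_sub_le (g : L ≃ₐ[M] L) (i : ℕ) (x : L) : w ((g ^ i) x - x) ≤ w (g x - x) := by
  induction i with
  | zero => simp
  | succ i ih => exact (hw.abs_mul_map_sub_le hϖ _ _ _).trans (max_le ih le_rfl)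

theorem ramProd_le_mul {N H : Subgroup (L ≃ₐ[M] L)} [Fintype N] [Fintype H] (hNH : N ≤ H)
    {σ : L ≃ₐ[M] L} (hσ : σ ∈ H) {p : ℕ} (hp : 0 < p) (hσN : ∀ i, 0 < i → i < p → σ ^ i ∉ N)
    {b : ℝ} (hb : ∀ x, (∀ h ∈ N, h x = x) → w x ≤ 1 → w (σ x - x) ≤ b) {r : ℝ} (hr : r ≤ 1) :
    ramProd w ϖ H r ≤ ramProd w ϖ N r * max b (ramProd w ϖ N r) ^ (p - 1) := by
  obtain ⟨m, rfl⟩ := Nat.exists_eq_add_of_lt hp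
  let F : (L ≃ₐ[M] L) → ℝ := fun h => max (w (h ϖ - ϖ)) r
  have hF0 : ∀ h, 0 ≤ F h := fun h => (w.nonneg _).trans (le_max_left _ _)
  have hF1 : ∀ h, F h ≤ 1 := fun h =>
    max_le ((hw.abs_map_sub_le_self hϖ h ϖ).trans hϖ.lt_one.le) hr
  let φ : Fin (0 + m + 1) × N → H := fun x =>
    ⟨σ ^ (x.1 : ℕ) * (x.2 : L ≃ₐ[M] L), mul_mem (pow_mem hσ _) (hNH x.2.2)⟩
  have hφ : Function.Injective φ := fun x y hxy =>
    injective_pow_mul hσN (congrArg Subtype.val hxy)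
  have hcoset : ∀ i : ℕ, ∏ h : N, F (σ ^ i * (h : L ≃ₐ[M] L)) ≤ max b (ramProd w ϖ N r) :=
    fun i => prod_coset_max_le hw hϖ N (σ ^ i) (prod_coset_le hw hϖ N _ fun x hx hx1 =>
      (abs_pow_map_sub_le hw hϖ σ i x).trans (hb x hx hx1)) r
  calc ramProd w ϖ H r
      ≤ ∏ x : Fin (0 + m + 1) × N, F (σ ^ (x.1 : ℕ) * (x.2 : L ≃ₐ[M] L)) :=
        prod_le_prod_comp_of_injective (f := fun h : H => F h) (fun h => hF0 h) (fun h => hF1 h) hφ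
    _ = ramProd w ϖ N r *
          ∏ i : Fin (0 + m), ∏ h : N, F (σ ^ (i.succ : ℕ) * (h : L ≃ₐ[M] L)) := by
        rw [Fintype.prod_prod_type, Fin.prod_univ_succ]
        simp only [Fin.val_zero, pow_zero, one_mul]
        rfl
    _ ≤ ramProd w ϖ N r * ∏ _i : Fin (0 + m), max b (ramProd w ϖ N r) :=
        mul_le_mul_of_nonneg_left (prod_le_prod (fun _ _ => prod_nonneg fun _ _ => hF0 _)
          fun i _ => hcoset _) (ramProd_nonneg N r)
    _ = ramProd w ϖ N r * max b (ramProd w ϖ N r) ^ (0 + m + 1 - 1) := by simp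

end ValueGen

open MulAction in
theorem IsMonogenic.prod_conj_mul_le (hϖ : IsMonogenic A w ϖ) [Fintype (L ≃ₐ[M] L)]
    [DecidableEq L] {y : L} (hy1 : w y ≤ 1) (g : L ≃ₐ[M] L) :
    (∏ η ∈ (univ.image fun h : L ≃ₐ[M] L => h y).erase y, w (η - y)) * w (g y - y) ≤
      ∏ h : L ≃ₐ[M] L, max (w (h ϖ - ϖ)) (w (g ϖ - ϖ)) := by
  classical
  let F : (L ≃ₐ[M] L) → ℝ := fun h => max (w (h ϖ - ϖ)) (w (g ϖ - ϖ))
  have hfix : ∀ h ∈ stabilizer (L ≃ₐ[M] L) y, h y = y := fun _ hh => hh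
  have hcoset : ∀ s : L ≃ₐ[M] L, w (s y - y) ≤ ∏ h with h y = s y, F h := fun s => by
    refine le_of_le_of_eq ?_ (prod_filter_smul_eq s y F).symm
    exact (hϖ.le_prod_coset _ s hfix hy1).trans
      (prod_le_prod (fun _ _ => w.nonneg _) fun _ _ => le_max_left _ _)
  have hone : w (g y - y) ≤ ∏ h with h y = y, F h := by
    have := prod_filter_smul_eq (1 : L ≃ₐ[M] L) y F
    simp only [one_smul, one_mul] at this
    refine le_of_le_of_eq ?_ this.symm
    refine (hϖ.le_prod_coset _ g hfix hy1).trans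
      (prod_le_prod (fun _ _ => w.nonneg _) fun h _ => ?_)
    exact (hϖ.abs_mul_map_sub_le hϖ.toIsValueGen g h ϖ).trans_eq (max_comm _ _)
  have hy : y ∈ univ.image fun h : L ≃ₐ[M] L => h y := mem_image.2 ⟨1, mem_univ _, rfl⟩
  rw [← prod_fiberwise_of_maps_to (t := univ.image fun h : L ≃ₐ[M] L => h y)
    (fun h _ => mem_image_of_mem (fun h : L ≃ₐ[M] L => h y) (mem_univ h)) F,
    ← mul_prod_erase _ _ hy, mul_comm]
  refine mul_le_mul hone (prod_le_prod (fun _ _ => w.nonneg _) fun η hη => ?_)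
    (prod_nonneg fun _ _ => w.nonneg _) ((w.nonneg _).trans hone)
  obtain ⟨s, -, rfl⟩ := mem_image.1 (mem_of_mem_erase hη)
  exact hcoset s

end RamProd

/-! ### Extending the absolute value of a complete discrete valuation ring -/

section Adic

variable {A K : Type*} [CommRing A] [Field K] [Algebra A K]

theorem IsIntegralAbs.le_one_iff_exists [IsIntegrallyClosed A] [IsFractionRing A K]
    {w : AbsoluteValue K ℝ} (hw : IsIntegralAbs A w) (x : K) :
    w x ≤ 1 ↔ ∃ a : A, algebraMap A K a = x := by
  rw [← hw.isIntegral_iff, IsIntegrallyClosed.isIntegral_iff]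

theorem IsIntegralAbs.pow_dvd_of_le [IsIntegrallyClosed A] [IsFractionRing A K]
    {w : AbsoluteValue K ℝ} (hw : IsIntegralAbs A w) {ϖ a : A} (hϖ : ϖ ≠ 0) {n : ℕ}
    (h : w (algebraMap A K a) ≤ w (algebraMap A K ϖ) ^ n) : ϖ ^ n ∣ a := by
  have hϖ0 : algebraMap A K ϖ ^ n ≠ 0 :=
    pow_ne_zero n (by simpa using hϖ)
  obtain ⟨b, hb⟩ := (hw.le_one_iff_exists (algebraMap A K a / algebraMap A K ϖ ^ n)).1 (by
    rw [map_div₀, map_pow]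
    exact div_le_one_of_le₀ h (pow_nonneg (w.nonneg _) n))
  refine ⟨b, IsFractionRing.injective A K ?_⟩
  rw [map_mul, map_pow, hb, mul_div_cancel₀ _ hϖ0]

theorem exists_eq_zpow_mul_unit [IsDomain A] [IsDiscreteValuationRing A] [IsFractionRing A K]
    {ϖ : A} (hϖ : Irreducible ϖ) {x : K} (hx : x ≠ 0) :
    ∃ (n : ℤ) (u : Aˣ), x = algebraMap A K ϖ ^ n * algebraMap A K u := by
  have hϖ0 : algebraMap A K ϖ ≠ 0 := by simpa using hϖ.ne_zero
  obtain ⟨a, b, hb, rfl⟩ := IsFractionRing.div_surjective (A := A) x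
  have ha : a ≠ 0 := by
    rintro rfl
    simp at hx
  obtain ⟨m, u, rfl⟩ := IsDiscreteValuationRing.eq_unit_mul_pow_irreducible ha hϖ
  obtain ⟨n, v, rfl⟩ := IsDiscreteValuationRing.eq_unit_mul_pow_irreducible
    (nonZeroDivisors.ne_zero hb) hϖ
  refine ⟨(m : ℤ) - n, u * v⁻¹, ?_⟩
  rw [Units.val_mul, zpow_sub₀ hϖ0, map_mul, map_mul, map_mul, map_pow, map_pow,
    map_units_inv, zpow_natCast, zpow_natCast]
  field_simp

theorem exists_isIntegralAbs_isValueGen [IsDomain A] [IsDiscreteValuationRing A]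
    [IsFractionRing A K] {ϖ : A} (hϖ : Irreducible ϖ) :
    ∃ w : AbsoluteValue K ℝ, IsIntegralAbs A w ∧ IsValueGen w (algebraMap A K ϖ) := by
  set v := IsDiscreteValuationRing.maximalIdeal A
  have hb : (1 : NNReal) < 2 := one_lt_two
  set w : AbsoluteValue K ℝ := v.adicAbv hb
  have hunit : ∀ u : Aˣ, w (algebraMap A K u) = 1 := fun u => by
    rw [v.adicAbv_coe_eq_one_iff]
    exact fun h => (IsLocalRing.mem_maximalIdeal _).1 h u.isUnit
  have hgen : IsValueGen w (algebraMap A K ϖ) := by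
    refine ⟨w.pos (by simpa using hϖ.ne_zero), ?_, fun x hx => ?_⟩
    · rw [v.adicAbv_coe_lt_one_iff]
      exact (IsLocalRing.mem_maximalIdeal _).2 hϖ.not_isUnit
    · obtain ⟨n, u, rfl⟩ := exists_eq_zpow_mul_unit hϖ hx
      exact ⟨n, by rw [map_mul, hunit, mul_one, map_zpow₀]⟩
  refine ⟨w, ⟨v.isNonarchimedean_adicAbv hb, fun x => ?_⟩, hgen⟩
  rw [IsIntegrallyClosed.isIntegral_iff]
  refine ⟨fun ⟨a, ha⟩ => ha ▸ v.adicAbv_coe_le_one hb a, fun hx => ?_⟩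
  rcases eq_or_ne x 0 with rfl | h0
  · exact ⟨0, map_zero _⟩
  obtain ⟨n, u, rfl⟩ := exists_eq_zpow_mul_unit hϖ h0
  rw [map_mul, hunit, mul_one, map_zpow₀] at hx
  have hn : 0 ≤ n := by
    by_contra! h
    exact hx.not_gt (one_lt_zpow_of_neg₀ hgen.pos hgen.lt_one h)
  lift n to ℕ using hn
  exact ⟨ϖ ^ n * u, by simp⟩

theorem completeSpace_of_isPrecomplete [IsDomain A] [IsIntegrallyClosed A] [IsFractionRing A K]
    {ϖ : A} [IsPrecomplete (Ideal.span {ϖ}) A] {w : AbsoluteValue K ℝ} (hw : IsIntegralAbs A w)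
    (hϖ : IsValueGen w (algebraMap A K ϖ)) :
    letI := w.toNormedField
    CompleteSpace K := by
  let := w.toNormedField
  have hdist : ∀ x y : K, dist x y = w (x - y) := fun x y => dist_eq_norm x y
  have hϖ0 : ϖ ≠ 0 := fun h => hϖ.ne_zero (by rw [h, map_zero])
  refine Metric.complete_of_convergent_controlled_sequences
    (fun n => w (algebraMap A K ϖ) ^ n) (fun n => pow_pos hϖ.pos n) fun u hu => ?_
  have hint : ∀ n, ∃ a : A, algebraMap A K a = u n - u 0 := fun n => by
    rw [← hw.le_one_iff_exists, ← hdist]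
    simpa using (hu 0 n 0 (Nat.zero_le _) le_rfl).le
  choose a ha using hint
  have hcauchy : ∀ {m n : ℕ}, m ≤ n →
      a m ≡ a n [SMOD (Ideal.span {ϖ} ^ m • ⊤ : Submodule A A)] := fun {m n} hmn => by
    rw [SModEq.sub_mem, smul_eq_mul, Ideal.mul_top, Ideal.span_singleton_pow,
      Ideal.mem_span_singleton]
    refine hw.pow_dvd_of_le hϖ0 ?_
    rw [map_sub, ha, ha, sub_sub_sub_cancel_right, ← hdist]
    exact (hu m m n le_rfl hmn).le
  obtain ⟨l, hl⟩ := IsPrecomplete.prec ‹_› hcauchy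
  refine ⟨u 0 + algebraMap A K l, tendsto_iff_dist_tendsto_zero.2 ?_⟩
  refine squeeze_zero (fun _ => dist_nonneg) (fun n => ?_)
    (tendsto_pow_atTop_nhds_zero_of_lt_one hϖ.pos.le hϖ.lt_one)
  have hln := hl n
  rw [SModEq.sub_mem, smul_eq_mul, Ideal.mul_top, Ideal.span_singleton_pow,
    Ideal.mem_span_singleton] at hln
  obtain ⟨z, hz⟩ := hln
  have hsub : u n - (u 0 + algebraMap A K l) = algebraMap A K ϖ ^ n * algebraMap A K z := by
    rw [← map_pow, ← map_mul, ← hz, map_sub, ha]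
    ring
  rw [hdist, hsub, map_mul, map_pow]
  exact mul_le_of_le_one_right (pow_nonneg hϖ.pos.le _) ((hw.le_one_iff_exists _).2 ⟨z, rfl⟩)

end Adic

section Spectral

theorem isIntegral_iff_spectralNorm_le_one {A K L : Type*} [CommRing A] [IsDomain A]
    [IsIntegrallyClosed A] [NormedField K] [Algebra A K] [IsFractionRing A K] [Field L]
    [Algebra K L] [Algebra.IsAlgebraic K L] [Algebra A L] [IsScalarTower A K L]
    (hA : ∀ x : K, ‖x‖ ≤ 1 ↔ ∃ a : A, algebraMap A K a = x) (x : L) :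
    IsIntegral A x ↔ spectralNorm K L x ≤ 1 := by
  have hmonic : (minpoly K x).Monic := minpoly.monic (Algebra.IsIntegral.isIntegral x)
  rw [spectralNorm, spectralValue_le_one_iff hmonic]
  refine ⟨fun hx n => ?_, fun h => ?_⟩
  · rw [hA, minpoly.isIntegrallyClosed_eq_field_fractions' K hx, coeff_map]
    exact ⟨_, rfl⟩
  · have hlifts : minpoly K x ∈ lifts (algebraMap A K) :=
      (lifts_iff_coeff_lifts _).2 fun n => (hA _).1 (h n)
    obtain ⟨P, hP, -, hPm⟩ := lifts_and_natDegree_eq_and_monic hlifts hmonic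
    refine ⟨P, hPm, ?_⟩
    have haeval := minpoly.aeval K x
    rwa [← hP, aeval_map_algebraMap] at haeval

theorem spectralNorm_pow_natDegree {K L : Type*} [NontriviallyNormedField K] [CompleteSpace K]
    [IsUltrametricDist K] [Field L] [Algebra K L] [Algebra.IsAlgebraic K L] (x : L) :
    spectralNorm K L x ^ (minpoly K x).natDegree = ‖(minpoly K x).coeff 0‖ := by
  have hdeg := minpoly.natDegree_pos (Algebra.IsIntegral.isIntegral (R := K) x)
  rw [spectralNorm.spectralNorm_eq_norm_coeff_zero_rpow, ← Real.rpow_natCast,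
    ← Real.rpow_mul (norm_nonneg _), one_div, inv_mul_cancel₀ (by exact_mod_cast hdeg.ne'),
    Real.rpow_one]

/-- The spectral norm, as an absolute value. -/
def spectralAbs (K L : Type*) [NontriviallyNormedField K] [CompleteSpace K] [IsUltrametricDist K]
    [Field L] [Algebra K L] [Algebra.IsAlgebraic K L] : AbsoluteValue L ℝ where
  toFun := spectralNorm K L
  map_mul' := spectralAlgNorm_mul
  nonneg' := spectralNorm_nonneg
  eq_zero' x := ⟨fun h => eq_zero_of_map_spectralNorm_eq_zero h (Algebra.IsAlgebraic.isAlgebraic x),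
    fun h => h ▸ spectralNorm_zero⟩
  add_le' _ _ := isNonarchimedean_spectralNorm.add_le spectralNorm_nonneg

/-- An absolute value on an algebraic extension `L` of `K = Frac A`, where `A` is a complete
discrete valuation ring with uniformizer `ϖ`, extending the one defined by `A`. -/
structure IsExtendedAbs (A K : Type*) {L : Type*} [CommRing A] [Field K] [Field L] [Algebra K L]
    [Algebra A L] (w : AbsoluteValue L ℝ) (ϖ : L) : Prop extends IsIntegralAbs A w where
  pos : 0 < w ϖ
  lt_one : w ϖ < 1
  exists_zpow : ∀ (E : IntermediateField K L) [FiniteDimensional K E], ∀ x ∈ E, x ≠ 0 →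
    ∃ n : ℤ, w x ^ Module.finrank K E = w ϖ ^ n

theorem exists_isExtendedAbs {A : Type*} (K L : Type*) [CommRing A] [IsDomain A]
    [IsDiscreteValuationRing A] [Field K] [Algebra A K] [IsFractionRing A K] [Field L] [Algebra K L]
    [Algebra.IsAlgebraic K L] [Algebra A L] [IsScalarTower A K L] {ϖ : A} (hϖ : Irreducible ϖ)
    [IsPrecomplete (Ideal.span {ϖ}) A] :
    ∃ w : AbsoluteValue L ℝ, IsExtendedAbs A K w (algebraMap A L ϖ) := by
  obtain ⟨w₀, hw₀, hgen⟩ := exists_isIntegralAbs_isValueGen (K := K) hϖ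
  let nf : NormedField K := w₀.toNormedField
  let : NontriviallyNormedField K :=
    { nf with
      non_trivial := by
        refine ⟨(algebraMap A K ϖ)⁻¹, ?_⟩
        change 1 < w₀ _
        rw [map_inv₀]
        exact (one_lt_inv₀ hgen.pos).2 hgen.lt_one }
  have : CompleteSpace K := completeSpace_of_isPrecomplete hw₀ hgen
  have : IsUltrametricDist K :=
    IsUltrametricDist.isUltrametricDist_of_isNonarchimedean_norm hw₀.nonarch
  have hϖ_eq : spectralAbs K L (algebraMap A L ϖ) = w₀ (algebraMap A K ϖ) := by
    rw [IsScalarTower.algebraMap_apply A K L]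
    exact spectralNorm_extends _
  refine ⟨spectralAbs K L, ⟨isNonarchimedean_spectralNorm,
    isIntegral_iff_spectralNorm_le_one hw₀.le_one_iff_exists⟩,
    hϖ_eq ▸ hgen.pos, hϖ_eq ▸ hgen.lt_one,
    fun E _ x hxE hx => ?_⟩
  obtain ⟨d, hd⟩ := minpoly.degree_dvd (K := K) (x := (⟨x, hxE⟩ : E))
    (Algebra.IsIntegral.isIntegral _)
  obtain ⟨n, hn⟩ := hgen.exists_zpow _
    (minpoly.coeff_zero_ne_zero (Algebra.IsIntegral.isIntegral (R := K) x) hx)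
  have hnorm : spectralAbs K L x ^ (minpoly K x).natDegree = w₀ (algebraMap A K ϖ) ^ n :=
    (spectralNorm_pow_natDegree x).trans hn
  refine ⟨n * d, ?_⟩
  rw [hd, IntermediateField.minpoly_eq, pow_mul, hnorm, hϖ_eq, zpow_mul, zpow_natCast]

end Spectral

/-! ### Uniformizers generate the ring of integers -/

section ExistsValueGen

variable {L : Type*} [Field L] {w : AbsoluteValue L ℝ} {q : ℝ} (hq0 : 0 < q) (hq1 : q < 1)
  {d : ℕ} (hd : d ≠ 0) (hpow : ∀ x, x ≠ 0 → ∃ n : ℤ, w x ^ d = q ^ n)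
include hq0 hq1 hd hpow

/- A nonzero element of least positive valuation generates the value group. -/
theorem exists_isValueGen_of_pow {x : L} (hx0 : x ≠ 0) (hx1 : w x < 1) :
    ∃ ϖ, IsValueGen w ϖ := by
  classical
  have hpos : ∀ y, ∀ n : ℤ, w y ^ d = q ^ n → (w y < 1 ↔ 0 < n) := fun y n hn => by
    rw [← pow_lt_one_iff_of_nonneg (w.nonneg y) hd, hn, zpow_lt_one_iff_right_of_lt_one₀ hq0 hq1]
  have hex : ∃ n : ℕ, 0 < n ∧ ∃ y, y ≠ 0 ∧ w y ^ d = q ^ n := by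
    obtain ⟨n, hn⟩ := hpow x hx0
    have hn0 : 0 < n := (hpos x n hn).1 hx1
    lift n to ℕ using hn0.le
    exact ⟨n, by exact_mod_cast hn0, x, hx0, by exact_mod_cast hn⟩
  obtain ⟨hN, ϖ, hϖ0, hϖ⟩ := Nat.find_spec hex
  set N := Nat.find hex
  refine ⟨ϖ, w.pos hϖ0, (hpos ϖ N (by exact_mod_cast hϖ)).2 (by exact_mod_cast hN),
    fun y hy => ?_⟩
  obtain ⟨m, hm⟩ := hpow y hy
  have hquot : w (y / ϖ ^ (m / N)) ^ d = q ^ (m % N) := by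
    rw [Int.emod_def, zpow_sub₀ hq0.ne', ← hm, zpow_mul, zpow_natCast, ← hϖ, map_div₀, map_zpow₀,
      div_pow, ← zpow_natCast, ← zpow_natCast, ← zpow_natCast, ← zpow_mul, ← zpow_mul, mul_comm]
  have hrem : m % N = 0 := by
    have hlt := Int.emod_lt_of_pos m (by exact_mod_cast hN : (0 : ℤ) < N)
    have hnonneg := Int.emod_nonneg m (by exact_mod_cast hN.ne' : (N : ℤ) ≠ 0)
    lift m % N to ℕ using hnonneg with r hr
    by_contra hr0
    exact Nat.find_min hex (by exact_mod_cast hlt) ⟨Nat.pos_of_ne_zero (by exact_mod_cast hr0), _,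
      div_ne_zero hy (zpow_ne_zero _ hϖ0), by exact_mod_cast hquot⟩
  refine ⟨m / N, ?_⟩
  rw [hrem, zpow_zero, pow_eq_one_iff_of_nonneg (w.nonneg _) hd, map_div₀, map_zpow₀,
    div_eq_one_iff_eq (zpow_ne_zero _ (w.pos hϖ0).ne')] at hquot
  exact hquot

theorem isValueGen_of_pow_eq {ϖ : L} (hϖ : w ϖ ^ d = q) : IsValueGen w ϖ := by
  have hpos : 0 < w ϖ := (w.nonneg ϖ).lt_of_ne fun h => by
    rw [← h, zero_pow hd] at hϖ
    exact hq0.ne hϖ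
  refine ⟨hpos, (pow_lt_one_iff_of_nonneg hpos.le hd).1 (hϖ ▸ hq1), fun x hx => ?_⟩
  obtain ⟨n, hn⟩ := hpow x hx
  refine ⟨n, (pow_left_inj₀ (w.nonneg _) (zpow_nonneg hpos.le _) hd).1 ?_⟩
  rw [hn, ← hϖ, ← zpow_natCast, ← zpow_natCast, ← zpow_mul, ← zpow_mul, mul_comm]

end ExistsValueGen

section Generation

variable {A L : Type*} [CommRing A] [Field L] [Algebra A L] {w : AbsoluteValue L ℝ} {ϖ : L}
  (hw : IsIntegralAbs A w)
include hw

theorem abs_aeval_lt_one_of_coeff {x : L} (hx : w x ≤ 1) {P : A[X]}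
    (hP : ∀ i, w (algebraMap A L (P.coeff i)) < 1) : w (aeval x P) < 1 := by
  rw [aeval_eq_sum_range]
  refine (hw.nonarch.apply_sum_le_sup ⟨0, mem_range.2 (Nat.succ_pos _)⟩).trans_lt
    ((sup'_lt_iff _).2 fun i _ => ?_)
  rw [Algebra.smul_def, map_mul, map_pow]
  exact (mul_le_of_le_one_right (w.nonneg _) (pow_le_one₀ (w.nonneg _) hx)).trans_lt (hP i)

/- If `f` is an integral equation of `x`, and `F` lifts the factorization of `f` modulo `ker c` into
linear factors, then `F(x) = F(x) - f(x)` is small, hence so is one of the factors of `F(x)`. -/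
theorem exists_abs_sub_algebraMap_lt_one {κ : Type*} [Field κ] [IsAlgClosed κ] {c : A →+* κ}
    (hc : Function.Surjective c) (hker : ∀ a, c a = 0 → w (algebraMap A L a) < 1) {x : L}
    (hx : w x ≤ 1) : ∃ a : A, w (x - algebraMap A L a) < 1 := by
  obtain ⟨f, hf, hfx⟩ := (hw.isIntegral_iff x).2 hx
  obtain ⟨s, hs⟩ := hc.hasRightInverse
  set F : A[X] := ((f.map c).roots.map fun r => X - C (s r)).prod with hF
  have hFmap : F.map c = f.map c := by
    conv_rhs => rw [(IsAlgClosed.splits (f.map c)).eq_prod_roots_of_monic (hf.map c)]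
    rw [hF, Polynomial.map_multiset_prod, Multiset.map_map]
    congr 1
    refine Multiset.map_congr rfl fun r _ => ?_
    rw [Function.comp_apply, Polynomial.map_sub, map_X, map_C, hs r]
  have hFx : w (aeval x F) < 1 := by
    have hsub : aeval x F = aeval x (F - f) := by rw [map_sub, aeval_def x f, hfx, sub_zero]
    rw [hsub]
    refine abs_aeval_lt_one_of_coeff hw hx fun i => hker _ ?_
    rw [← coeff_map, Polynomial.map_sub, hFmap, sub_self, coeff_zero]
  by_contra! hfar
  rw [hF, map_multiset_prod, map_multiset_prod, Multiset.map_map, Multiset.map_map] at hFx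
  refine hFx.not_ge (Multiset.one_le_prod_map fun r _ => ?_)
  simpa using hfar (s r)

variable (hϖ : IsValueGen w ϖ)
  (hres : ∀ x : L, w x ≤ 1 → ∃ a : A, w (x - algebraMap A L a) < 1)
include hϖ hres

omit hw in
theorem exists_aeval_add_pow_mul (e : ℕ) {x : L} (hx : w x ≤ 1) :
    ∃ (P : A[X]) (y : L), w y ≤ 1 ∧ x = aeval ϖ P + ϖ ^ e * y := by
  have hϖ0 := hϖ.ne_zero
  induction e with
  | zero => exact ⟨0, x, hx, by simp⟩
  | succ e ih =>
    obtain ⟨P, y, hy, rfl⟩ := ih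
    obtain ⟨a, ha⟩ := hres y hy
    refine ⟨P + X ^ e * C a, (y - algebraMap A L a) / ϖ, ?_, ?_⟩
    · rw [map_div₀, div_le_one hϖ.pos]
      exact hϖ.le_of_lt_one ha
    · simp only [map_add, map_mul, map_pow, aeval_X, aeval_C]
      field_simp
      ring

/- Nakayama's lemma: `A[ϖ]` is everything modulo a power of `ϖ` which generates `c`. -/
theorem isMonogenic_of_residue [IsLocalRing A] [Module.Finite A (integralClosure A L)] {c : A}
    (hc : c ∈ IsLocalRing.maximalIdeal A) (hc0 : algebraMap A L c ≠ 0) : IsMonogenic A w ϖ := by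
  set O := integralClosure A L
  set ϖO : O := hw.toInt ϖ hϖ.lt_one.le
  let S : Submodule A O := LinearMap.range (aeval (R := A) ϖO).toLinearMap
  have haeval : ∀ P : A[X], ((aeval ϖO P : O) : L) = aeval ϖ P := fun P =>
    (aeval_algebraMap_apply L ϖO P).symm
  obtain ⟨e, he⟩ := hϖ.exists_pow hc0 ((hw.isIntegral_iff _).1 isIntegral_algebraMap)
  have hunit : w (ϖ ^ e / algebraMap A L c) = 1 := by
    rw [map_div₀, map_pow, he, div_self (pow_pos hϖ.pos e).ne']
  have htop : (⊤ : Submodule A O) ≤ S ⊔ Ideal.span {c} • ⊤ := by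
    intro x _
    obtain ⟨P, y, hy, hxy⟩ := exists_aeval_add_pow_mul hϖ hres e (hw.coe_le_one x)
    have hz : w (ϖ ^ e / algebraMap A L c * y) ≤ 1 := by rwa [map_mul, hunit, one_mul]
    have hx : x = aeval ϖO P + c • hw.toInt _ hz := Subtype.ext <| by
      change (x : L) = ((aeval ϖO P : O) : L) + c • (ϖ ^ e / algebraMap A L c * y)
      rw [haeval, Algebra.smul_def, hxy]
      field_simp
    rw [hx]
    exact Submodule.add_mem_sup ⟨P, rfl⟩
      (Submodule.smul_mem_smul (Ideal.mem_span_singleton_self c) trivial)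
  have hjac : Ideal.span {c} ≤ (⊥ : Ideal A).jacobson := by
    rwa [IsLocalRing.jacobson_eq_maximalIdeal _ bot_ne_top, Ideal.span_singleton_le_iff_mem]
  have hS := Submodule.le_of_le_smul_of_le_jacobson_bot Module.Finite.fg_top hjac htop
  refine ⟨hw, hϖ, fun x hx => ?_⟩
  obtain ⟨P, hP⟩ := hS (Submodule.mem_top (x := hw.toInt x hx))
  exact ⟨P, (haeval P).symm.trans (congrArg Subtype.val hP)⟩

end Generation

/-! ### Roots of unity and binomial expansions -/

section RootsOfUnity

variable {A L : Type*} [CommRing A] [Field L] [Algebra A L] {w : AbsoluteValue L ℝ}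

theorem abs_eq_one_of_pow_eq_one (w : AbsoluteValue L ℝ) {η : L} {n : ℕ} (hn : n ≠ 0)
    (h : η ^ n = 1) : w η = 1 := by
  rw [← pow_eq_one_iff_of_nonneg (w.nonneg η) hn, ← map_pow, h, map_one]

namespace IsIntegralAbs

variable (hw : IsIntegralAbs A w)
include hw

theorem abs_natCast_le_one (n : ℕ) : w n ≤ 1 := by
  have h : IsIntegral A (algebraMap A L n) := isIntegral_algebraMap
  rwa [map_natCast, hw.isIntegral_iff] at h

theorem abs_pow_sub_one_le {x : L} (hx : w x ≤ 1) (i : ℕ) : w (x ^ i - 1) ≤ w (x - 1) := by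
  simpa using hw.abs_aeval_sub_le hx (map_one w).le (X ^ i)

theorem abs_sub_one_le_of_isPrimitiveRoot {n : ℕ} (hn : n ≠ 0) {ζ μ : L}
    (hζ : IsPrimitiveRoot ζ n) (hμ : μ ^ n = 1) : w (μ - 1) ≤ w (ζ - 1) := by
  have : NeZero n := ⟨hn⟩
  obtain ⟨i, -, rfl⟩ := hζ.eq_pow_of_pow_eq_one hμ
  exact hw.abs_pow_sub_one_le (abs_eq_one_of_pow_eq_one w hn hζ.pow_eq_one).le i

/- Evaluate the cyclotomic polynomial at `1`. -/
theorem abs_primitiveRoot_sub_one {p n : ℕ} [hp : Fact p.Prime] (hn : n ≠ 0) {ζ : L}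
    (hζ : IsPrimitiveRoot ζ (p ^ n)) : w (ζ - 1) ^ (p ^ n).totient = w p := by
  have hpn : p ^ n ≠ 0 := pow_ne_zero n hp.out.ne_zero
  have hprod : (p : L) = ∏ μ ∈ primitiveRoots (p ^ n) L, (1 - μ) := by
    obtain ⟨m, rfl⟩ := Nat.exists_eq_succ_of_ne_zero hn
    rw [← eval_one_cyclotomic_prime_pow (R := L) m, cyclotomic_eq_prod_X_sub_primitiveRoots hζ,
      eval_prod]
    simp
  rw [hprod, map_prod, ← hζ.card_primitiveRoots]
  refine (prod_eq_pow_card fun μ hμ => ?_).symm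
  have hμ' := isPrimitiveRoot_of_mem_primitiveRoots hμ
  rw [w.map_sub]
  exact le_antisymm (hw.abs_sub_one_le_of_isPrimitiveRoot hpn hζ hμ'.pow_eq_one)
    (hw.abs_sub_one_le_of_isPrimitiveRoot hpn hμ' hζ.pow_eq_one)

theorem abs_root_sub_one {p : ℕ} [hp : Fact p.Prime] {η : L} (h : η ^ p = 1) (h1 : η ≠ 1) :
    w (η - 1) ^ (p - 1) = w p := by
  have hη : IsPrimitiveRoot η (p ^ 1) := by
    rw [pow_one, ← orderOf_eq_prime h h1]
    exact .orderOf η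
  simpa [Nat.totient_prime hp.out] using hw.abs_primitiveRoot_sub_one one_ne_zero hη

theorem le_abs_root_sub_one_pow {p n : ℕ} [hp : Fact p.Prime] {η : L} (h : η ^ p ^ n = 1)
    (h1 : η ≠ 1) : w p ≤ w (η - 1) ^ (p - 1) := by
  obtain ⟨m, -, hm⟩ := (Nat.dvd_prime_pow hp.out).1 (orderOf_dvd_of_pow_eq_one h)
  have hη : IsPrimitiveRoot η (p ^ m) := hm ▸ .orderOf η
  have hm0 : m ≠ 0 := by
    rintro rfl
    exact h1 (by simpa using hη)
  have hle : w (η - 1) ≤ 1 := (abs_sub_le_max hw.nonarch _ _).trans (by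
    simp [abs_eq_one_of_pow_eq_one w (pow_ne_zero n hp.out.ne_zero) h])
  rw [← hw.abs_primitiveRoot_sub_one hm0 hη, Nat.totient_prime_pow hp.out (by lia)]
  exact pow_le_pow_of_le_one (w.nonneg _) hle
    (Nat.le_mul_of_pos_left _ (pow_pos hp.out.pos _))

theorem abs_natCast_le_prod_root_sub_one {n : ℕ} (hn : n ≠ 0) {μ : L}
    (hμ : IsPrimitiveRoot μ n) (T : Finset L) (hT : ∀ η ∈ T, η ^ n = 1 ∧ η ≠ 1) :
    w n ≤ ∏ η ∈ T, w (η - 1) := by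
  classical
  obtain ⟨m, rfl⟩ := Nat.exists_eq_succ_of_ne_zero hn
  have hinj : Set.InjOn (fun i => μ ^ (i + 1)) (range m : Set ℕ) := fun i hi j hj hij => by
    rw [coe_range, Set.mem_Iio] at hi hj
    exact Nat.succ_injective (hμ.pow_inj (Nat.succ_lt_succ hi) (Nat.succ_lt_succ hj) hij)
  have hfull : w (m + 1 : ℕ) = ∏ η ∈ (range m).image fun i => μ ^ (i + 1), w (η - 1) := by
    rw [Nat.cast_add_one, ← hμ.prod_one_sub_pow_eq_order, map_prod, prod_image hinj]
    exact prod_congr rfl fun i _ => w.map_sub _ _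
  have hsub : T ⊆ (range m).image fun i => μ ^ (i + 1) := fun η hη => by
    obtain ⟨hη, hη1⟩ := hT η hη
    obtain ⟨_ | i, hi, rfl⟩ := hμ.eq_pow_of_pow_eq_one hη
    · exact absurd (pow_zero μ) hη1
    · exact mem_image.2 ⟨i, mem_range.2 (Nat.succ_lt_succ_iff.1 hi), rfl⟩
  rw [hfull, ← prod_sdiff hsub]
  refine mul_le_of_le_one_left (prod_nonneg fun _ _ => w.nonneg _)
    (prod_le_one (fun _ _ => w.nonneg _) fun η hη => ?_)
  obtain ⟨i, -, rfl⟩ := mem_image.1 (sdiff_subset hη)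
  exact (abs_sub_le_max hw.nonarch _ _).trans (by
    simp [abs_eq_one_of_pow_eq_one w hn hμ.pow_eq_one])

variable {p : ℕ} [hp : Fact p.Prime]

theorem abs_natCast_eq_one (hwp : w p < 1) {r : ℕ} (hr : ¬p ∣ r) : w r = 1 := by
  have hbez : (r : ℤ) * r.gcdA p + p * r.gcdB p = 1 := by
    rw [← Nat.gcd_eq_gcd_ab, (hp.out.coprime_iff_not_dvd.2 hr).symm.gcd_eq_one, Nat.cast_one]
  have hint (m : ℤ) : w m ≤ 1 := (hw.isIntegral_iff _).1 (by
    simpa using isIntegral_algebraMap (R := A) (A := L) (x := (m : A)))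
  refine (hw.abs_natCast_le_one r).antisymm (le_of_not_gt fun hlt => ?_)
  have hone : w ((r : L) * r.gcdA p + p * r.gcdB p) = 1 := by
    rw [← map_one w]
    congr 1
    exact_mod_cast congrArg (Int.cast (R := L)) hbez
  refine ((hw.nonarch _ _).trans_lt (max_lt ?_ ?_)).ne hone
  · rw [map_mul]
    exact (mul_le_of_le_one_right (w.nonneg _) (hint _)).trans_lt hlt
  · rw [map_mul]
    exact (mul_le_of_le_one_right (w.nonneg _) (hint _)).trans_lt hwp

theorem abs_one_add_pow_sub_one (hwp : w p < 1) {r : ℕ} (hr : ¬p ∣ r) {y : L} (hy : w y < 1) :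
    w ((1 + y) ^ r - 1) = w y := by
  obtain ⟨z, hz⟩ := powAddExpansion 1 (hw.toInt y hy.le) r
  have hexp : (1 + y) ^ r - 1 = y * (r + y * z) := by
    have h : (1 + y) ^ r = 1 ^ r + r * 1 ^ (r - 1) * y + z * y ^ 2 := by
      simpa only [map_add, map_mul, map_pow, map_one, map_natCast, Subalgebra.coe_val, hw.coe_toInt]
        using congrArg (integralClosure A L).val hz
    rw [h, one_pow, one_pow]
    ring
  have hr1 := hw.abs_natCast_eq_one hwp hr
  have hsmall : w (y * z) < w r := by
    rw [hr1, map_mul]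
    exact (mul_le_of_le_one_right (w.nonneg _) (hw.coe_le_one z)).trans_lt hy
  rw [hexp, map_mul, hw.nonarch.add_eq_left_of_lt hsmall, hr1, mul_one]

/- With `x = β - 1` we have `β ^ p - 1 = x ^ p + p x r` with `r` integral, and the hypothesis says
that the first term dominates. -/
theorem abs_sub_one_pow {β : L} (hβ : w β ≤ 1) (h : w p ^ p < w (β ^ p - 1) ^ (p - 1)) :
    w (β - 1) ^ p = w (β ^ p - 1) := by
  have hx1 : w (β - 1) ≤ 1 := (abs_sub_le_max hw.nonarch _ _).trans (by simpa using hβ)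
  obtain ⟨r, hr⟩ := exists_add_pow_prime_eq hp.out (hw.toInt (β - 1) hx1) 1
  have hexp : β ^ p - 1 = (β - 1) ^ p + p * (β - 1) * r := by
    have h : (β - 1 + 1) ^ p = (β - 1) ^ p + 1 ^ p + p * (β - 1) * 1 * r := by
      simpa only [map_add, map_mul, map_pow, map_one, map_natCast, Subalgebra.coe_val, hw.coe_toInt]
        using congrArg (integralClosure A L).val hr
    rw [sub_add_cancel, one_pow, mul_one] at h
    rw [h]
    ring
  have hsnd : w (p * (β - 1) * r) ≤ w p * w (β - 1) := by
    rw [map_mul, map_mul]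
    exact mul_le_of_le_one_right (by positivity) (hw.coe_le_one r)
  have hfst : w (p * (β - 1) * r) < w ((β - 1) ^ p) := by
    rw [map_pow]
    refine hsnd.trans_lt (lt_of_not_ge fun hge => h.not_ge ?_)
    have hle : w (β ^ p - 1) ≤ w p * w (β - 1) := by
      rw [hexp]
      exact (hw.nonarch _ _).trans (max_le (by rwa [map_pow]) hsnd)
    have hxp : w (β - 1) ^ (p - 1) ≤ w p := by
      rcases (w.nonneg (β - 1)).eq_or_lt with h0 | h0
      · rw [← h0, zero_pow (Nat.sub_pos_of_lt hp.out.one_lt).ne']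
        exact w.nonneg _
      · rw [← Nat.sub_add_cancel hp.out.one_le, pow_succ, Nat.sub_add_cancel hp.out.one_le] at hge
        exact le_of_mul_le_mul_right hge h0
    calc w (β ^ p - 1) ^ (p - 1) ≤ (w p * w (β - 1)) ^ (p - 1) :=
          pow_le_pow_left₀ (w.nonneg _) hle _
      _ ≤ w p ^ (p - 1) * w p := by
          rw [mul_pow]
          gcongr
      _ = w p ^ p := by rw [← pow_succ, Nat.sub_add_cancel hp.out.one_le]
  rw [hexp, hw.nonarch.add_eq_left_of_lt hfst, map_pow]

end IsIntegralAbs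

end RootsOfUnity

/-! ### The `p`-adic absolute value -/

section Restrict

variable {K L : Type*} [Field K] [Field L] [Algebra K L]

/-- The restriction of an absolute value to an intermediate field. -/
def absRestrict (w : AbsoluteValue L ℝ) (E : IntermediateField K L) : AbsoluteValue E ℝ :=
  w.comp (algebraMap E L).injective

@[simp]
theorem absRestrict_apply (w : AbsoluteValue L ℝ) (E : IntermediateField K L) (x : E) :
    absRestrict w E x = w x :=
  rfl

theorem IsIntegralAbs.absRestrict {A : Type*} [CommRing A] [Algebra A K] [Algebra A L]
    [IsScalarTower A K L] {w : AbsoluteValue L ℝ} (hw : IsIntegralAbs A w)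
    (E : IntermediateField K L) : IsIntegralAbs A (absRestrict w E) where
  nonarch x y := hw.nonarch (x : L) y
  isIntegral_iff x := by
    have : IsScalarTower A E L := IsScalarTower.of_algebraMap_eq fun _ => rfl
    rw [absRestrict_apply, ← hw.isIntegral_iff]
    exact (isIntegral_algebraMap_iff (algebraMap E L).injective).symm

end Restrict

section Padic

open IntermediateField

variable (p : ℕ) [Fact p.Prime] (k : Type*) [Field k] [CharP k p]

instance charZero_wittVector : CharZero (WittVector p k) := by
  obtain ⟨r, hr⟩ := CharP.exists (WittVector p k)
  rcases CharP.char_is_prime_or_zero (WittVector p k) r with hprime | rfl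
  · have hr0 : (r : k) = 0 := by
      rw [← map_natCast (WittVector.constantCoeff (p := p)), CharP.cast_eq_zero, map_zero]
    rw [CharP.cast_eq_zero_iff k p, Nat.prime_dvd_prime_iff_eq Fact.out hprime] at hr0
    subst hr0
    exact absurd (CharP.cast_eq_zero _ _) (WittVector.p_nonzero p k)
  · exact CharP.charP_to_charZero _

instance charZero_K0 : CharZero (K0 p k) :=
  charZero_of_injective_algebraMap (IsFractionRing.injective (WittVector p k) (K0 p k))

instance charZero_Kbar : CharZero (Kbar p k) :=
  charZero_of_injective_algebraMap (algebraMap (K0 p k) (Kbar p k)).injective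

variable {p k}

/-- The `p`-adic absolute value on `Kbar`, up to normalization. -/
abbrev IsPadicAbs (w : AbsoluteValue (Kbar p k) ℝ) : Prop :=
  IsExtendedAbs (WittVector p k) (K0 p k) w (p : Kbar p k)

theorem exists_isPadicAbs (p : ℕ) [Fact p.Prime] (k : Type*) [Field k] [CharP k p]
    [IsAlgClosed k] : ∃ w : AbsoluteValue (Kbar p k) ℝ, IsPadicAbs w := by
  obtain ⟨w, hw⟩ := exists_isExtendedAbs (K0 p k) (Kbar p k) (WittVector.irreducible p (k := k))
  exact ⟨w, by rwa [map_natCast] at hw⟩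

namespace IsPadicAbs

variable {w : AbsoluteValue (Kbar p k) ℝ} (hw : IsPadicAbs w)
  (E : IntermediateField (K0 p k) (Kbar p k)) [FiniteDimensional (K0 p k) E]
include hw

theorem exists_isValueGen : ∃ ϖ : E, IsValueGen (absRestrict w E) ϖ :=
  exists_isValueGen_of_pow (w := WildConductor.absRestrict w E) hw.pos
    hw.lt_one Module.finrank_pos.ne' (fun (x : E) hx => hw.exists_zpow E x x.2 (by simpa using hx))
    (x := (p : E)) (Nat.cast_ne_zero.2 (Fact.out : p.Prime).ne_zero) (by simpa using hw.lt_one)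

theorem isValueGen_of_pow_eq {ϖ : E} (hϖ : w (ϖ : Kbar p k) ^ Module.finrank (K0 p k) E = w p) :
    IsValueGen (absRestrict w E) ϖ :=
  WildConductor.isValueGen_of_pow_eq (w := WildConductor.absRestrict w E) hw.pos
    hw.lt_one Module.finrank_pos.ne' (fun (x : E) hx => hw.exists_zpow E x x.2 (by simpa using hx))
    hϖ

variable {E}

theorem isMonogenic [IsAlgClosed k] {ϖ : E} (hϖ : IsValueGen (absRestrict w E) ϖ) :
    IsMonogenic (WittVector p k) (absRestrict w E) ϖ := by
  have hwE := hw.absRestrict E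
  have : Module.Finite (WittVector p k) (integralClosure (WittVector p k) E) :=
    IsIntegralClosure.finite (WittVector p k) (K0 p k) E _
  have hker : ∀ a : WittVector p k, WittVector.constantCoeff a = 0 →
      absRestrict w E (algebraMap _ E a) < 1 := fun a ha => by
    rw [← RingHom.mem_ker, WittVector.ker_constantCoeff, Ideal.mem_span_singleton] at ha
    obtain ⟨b, rfl⟩ := ha
    rw [map_mul, map_mul, map_natCast]
    refine (mul_le_of_le_one_right (apply_nonneg _ _)
      ((hwE.isIntegral_iff _).1 isIntegral_algebraMap)).trans_lt ?_
    simpa using hw.lt_one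
  refine isMonogenic_of_residue hwE hϖ
    (fun x hx => exists_abs_sub_algebraMap_lt_one hwE (WittVector.constantCoeff_surjective p)
      hker hx) (c := (p : WittVector p k)) ?_ ?_
  · exact (IsLocalRing.mem_maximalIdeal _).2 (WittVector.irreducible p).not_isUnit
  · rw [map_natCast]
    exact Nat.cast_ne_zero.2 (Fact.out : p.Prime).ne_zero

theorem dvd_mul_finrank {x : Kbar p k} (hx : x ∈ E) {a b : ℕ} (ha : a ≠ 0)
    (h : w x ^ a = w p ^ b) : a ∣ b * Module.finrank (K0 p k) E := by
  have hx0 : x ≠ 0 := by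
    rintro rfl
    rw [map_zero, zero_pow ha] at h
    exact (pow_pos hw.pos b).ne h
  obtain ⟨m, hm⟩ := hw.exists_zpow E x hx hx0
  have heq : w p ^ (m * a) = w p ^ ((b * Module.finrank (K0 p k) E : ℕ) : ℤ) := by
    rw [zpow_mul, ← hm, zpow_natCast, zpow_natCast, ← pow_mul, mul_comm, pow_mul, h, pow_mul]
  rw [(zpow_right_strictAnti₀ hw.pos hw.lt_one).injective.eq_iff] at heq
  exact_mod_cast Dvd.intro_left m heq

end IsPadicAbs

end Padic

/-! ### Cyclotomic fields and adjunction of roots -/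

section Adjunction

open IntermediateField

variable {p : ℕ} [Fact p.Prime] {k : Type*} [Field k] [CharP k p]

theorem exists_isPrimitiveRoot (n : ℕ) : ∃ ζ : Kbar p k, IsPrimitiveRoot ζ (p ^ n) := by
  have : NeZero ((p ^ n : ℕ) : Kbar p k) :=
    ⟨Nat.cast_ne_zero.2 (pow_ne_zero n (Fact.out : p.Prime).ne_zero)⟩
  exact HasEnoughRootsOfUnity.exists_primitiveRoot (Kbar p k) (p ^ n)

theorem mem_cyc_of_pow_eq_one {n : ℕ} {η : Kbar p k} (h : η ^ p ^ n = 1) : η ∈ cyc p k n :=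
  subset_adjoin _ _ h

theorem cyc_eq_adjoin {n : ℕ} {ζ : Kbar p k} (hζ : IsPrimitiveRoot ζ (p ^ n)) :
    cyc p k n = adjoin (K0 p k) {ζ} := by
  have : NeZero (p ^ n) := ⟨pow_ne_zero _ (Fact.out : p.Prime).ne_zero⟩
  refine le_antisymm (adjoin_le_iff.2 fun η hη => ?_)
    (adjoin_simple_le_iff.2 (mem_cyc_of_pow_eq_one hζ.pow_eq_one))
  obtain ⟨i, -, rfl⟩ := hζ.eq_pow_of_pow_eq_one hη
  exact pow_mem (mem_adjoin_simple_self _ ζ) i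

theorem cycAdjoin_le_iff {n : ℕ} {β : Kbar p k} {E : IntermediateField (K0 p k) (Kbar p k)} :
    cycAdjoin p k n β ≤ E ↔ cyc p k n ≤ E ∧ β ∈ E := by
  refine ⟨fun h => ⟨fun x hx => h ?_, h (self_mem_cycAdjoin n β)⟩, fun ⟨hcyc, hβ⟩ x hx => ?_⟩
  · exact (adjoin (cyc p k n) {β}).algebraMap_mem ⟨x, hx⟩
  · exact (adjoin_simple_le_iff (K := extendScalars hcyc)).2 hβ hx

theorem cyc_le_cycAdjoin (n : ℕ) (β : Kbar p k) : cyc p k n ≤ cycAdjoin p k n β :=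
  (cycAdjoin_le_iff.1 le_rfl).1

theorem cyc_le_cycAdjoin_of_le {l c : ℕ} (hlc : l ≤ c) (β : Kbar p k) :
    cyc p k l ≤ cycAdjoin p k c β :=
  (cyc_mono hlc).trans (cyc_le_cycAdjoin c β)

theorem cycAdjoin_eq_cyc {n : ℕ} {β : Kbar p k} (h : β ∈ cyc p k n) :
    cycAdjoin p k n β = cyc p k n :=
  le_antisymm (cycAdjoin_le_iff.2 ⟨le_rfl, h⟩) (cyc_le_cycAdjoin n β)

instance finiteDimensional_cyc (n : ℕ) : FiniteDimensional (K0 p k) (cyc p k n) := by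
  obtain ⟨ζ, hζ⟩ := exists_isPrimitiveRoot (p := p) (k := k) n
  rw [cyc_eq_adjoin hζ]
  exact adjoin.finiteDimensional (Algebra.IsIntegral.isIntegral ζ)

instance finiteDimensional_cycAdjoin (n : ℕ) (β : Kbar p k) :
    FiniteDimensional (K0 p k) (cycAdjoin p k n β) :=
  have : FiniteDimensional (cyc p k n) (adjoin (cyc p k n) {β}) :=
    adjoin.finiteDimensional (Algebra.IsIntegral.isIntegral β)
  FiniteDimensional.trans (K0 p k) (cyc p k n) (adjoin (cyc p k n) {β})

theorem relfinrank_cycAdjoin_pow_le (n : ℕ) {m : ℕ} (hm : m ≠ 0) (β : Kbar p k) :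
    relfinrank (cycAdjoin p k n (β ^ m)) (cycAdjoin p k n β) ≤ m := by
  set M := cycAdjoin p k n (β ^ m)
  let b : M := ⟨β ^ m, self_mem_cycAdjoin n _⟩
  have hML : M ≤ cycAdjoin p k n β := cycAdjoin_pow_le n m β
  have hint : IsIntegral M β := Algebra.IsIntegral.isIntegral β
  have hadjoin : extendScalars hML = adjoin M {β} := by
    refine le_antisymm (fun x hx => ?_)
      (adjoin_simple_le_iff.2 (self_mem_cycAdjoin n β))
    refine (cycAdjoin_le_iff (E := (adjoin M {β}).restrictScalars (K0 p k))).2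
      ⟨fun y hy => ?_, mem_adjoin_simple_self M β⟩ hx
    exact (adjoin M {β}).algebraMap_mem ⟨y, cyc_le_cycAdjoin n _ hy⟩
  rw [relfinrank_eq_finrank_of_le hML, hadjoin, adjoin.finrank hint]
  refine (natDegree_le_natDegree (minpoly.min M β (monic_X_pow_sub_C b hm) ?_)).trans
    (natDegree_X_pow_sub_C).le
  rw [map_sub, map_pow, aeval_X, aeval_C]
  exact sub_self _

theorem IsPadicAbs.finrank_cyc {w : AbsoluteValue (Kbar p k) ℝ} (hw : IsPadicAbs w) {n : ℕ}
    (hn : n ≠ 0) : Module.finrank (K0 p k) (cyc p k n) = (p ^ n).totient := by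
  have hpn : 0 < p ^ n := pow_pos (Fact.out : p.Prime).pos n
  obtain ⟨ζ, hζ⟩ := exists_isPrimitiveRoot (p := p) (k := k) n
  refine le_antisymm ?_ (Nat.le_of_dvd Module.finrank_pos ?_)
  · have : NeZero ((p ^ n : ℕ) : Kbar p k) := ⟨Nat.cast_ne_zero.2 hpn.ne'⟩
    rw [cyc_eq_adjoin hζ, adjoin.finrank (Algebra.IsIntegral.isIntegral ζ),
      ← natDegree_cyclotomic (p ^ n) (K0 p k)]
    refine natDegree_le_of_dvd (minpoly.dvd _ _ ?_) (cyclotomic_ne_zero _ _)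
    rw [aeval_def, ← eval_map, map_cyclotomic]
    exact isRoot_cyclotomic_iff.2 hζ
  · have hmem : ζ - 1 ∈ cyc p k n := sub_mem (mem_cyc_of_pow_eq_one hζ.pow_eq_one) (one_mem _)
    simpa only [one_mul] using hw.dvd_mul_finrank hmem (Nat.totient_pos.2 hpn).ne'
      ((hw.abs_primitiveRoot_sub_one hn hζ).trans (pow_one _).symm)

end Adjunction

/-! ### Galois groups of radical extensions -/

section GaloisExt

open IntermediateField

variable {p : ℕ} [Fact p.Prime] {k : Type*} [Field k] [CharP k p]

theorem isGaloisExt_of_map_mem {M L : IntermediateField (K0 p k) (Kbar p k)} (h : M ≤ L)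
    (hσ : ∀ σ : Kbar p k ≃ₐ[K0 p k] Kbar p k, (∀ x ∈ M, σ x = x) → ∀ x ∈ L, σ x ∈ L) :
    IsGaloisExt h := by
  have : CharZero M := charZero_of_injective_algebraMap (algebraMap (K0 p k) M).injective
  have : Algebra.IsAlgebraic M (Kbar p k) := Algebra.IsAlgebraic.tower_top (K := K0 p k) M
  have : IsAlgClosure M (Kbar p k) := ⟨inferInstance, inferInstance⟩
  have : Normal M (Kbar p k) := IsAlgClosure.normal M (Kbar p k)
  have : Normal M (extendScalars h) := by
    rw [normal_iff_forall_map_le']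
    rintro σ _ ⟨x, hx, rfl⟩
    exact hσ (σ.restrictScalars (K0 p k)) (fun y hy => σ.commutes ⟨y, hy⟩) x hx
  exact (⟨⟩ : IsGalois M (extendScalars h))

theorem map_mem_cyc (σ : Kbar p k ≃ₐ[K0 p k] Kbar p k) (n : ℕ) {x : Kbar p k}
    (hx : x ∈ cyc p k n) : σ x ∈ cyc p k n := by
  refine (adjoin_le_iff (T := (cyc p k n).comap (σ : Kbar p k →ₐ[K0 p k] Kbar p k))).2
    (fun ζ (hζ : ζ ^ p ^ n = 1) => mem_cyc_of_pow_eq_one ?_) hx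
  rw [← map_pow, hζ, map_one]

theorem map_mem_cycAdjoin (σ : Kbar p k ≃ₐ[K0 p k] Kbar p k) (n : ℕ) {β : Kbar p k}
    (hβ : σ β ∈ cycAdjoin p k n β) {x : Kbar p k} (hx : x ∈ cycAdjoin p k n β) :
    σ x ∈ cycAdjoin p k n β :=
  (cycAdjoin_le_iff (E := (cycAdjoin p k n β).comap (σ : Kbar p k →ₐ[K0 p k] Kbar p k))).2
    ⟨fun _ hy => cyc_le_cycAdjoin n β (map_mem_cyc σ n hy), hβ⟩ hx

theorem map_root_mem_cycAdjoin (σ : Kbar p k ≃ₐ[K0 p k] Kbar p k) {n m : ℕ} (hmn : m ≤ n)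
    {β : Kbar p k} (hβ : σ (β ^ p ^ m) = β ^ p ^ m) : σ β ∈ cycAdjoin p k n β := by
  rcases eq_or_ne β 0 with rfl | h0
  · rw [map_zero]
    exact zero_mem _
  have hroot : (σ β / β) ^ p ^ m = 1 := by
    rw [div_pow, ← map_pow, hβ, div_self (pow_ne_zero _ h0)]
  rw [← div_mul_cancel₀ (σ β) h0]
  exact mul_mem (cyc_le_cycAdjoin n β (cyc_mono hmn (mem_cyc_of_pow_eq_one hroot)))
    (self_mem_cycAdjoin n β)

theorem isGaloisExt_cycAdjoin_mono {l c : ℕ} (hlc : l ≤ c) (β : Kbar p k) :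
    IsGaloisExt (cycAdjoin_mono hlc β) :=
  isGaloisExt_of_map_mem _ fun σ hσ _ hx => map_mem_cycAdjoin σ c
    ((hσ β (self_mem_cycAdjoin l β)).symm ▸ self_mem_cycAdjoin c β) hx

theorem isGaloisExt_cycAdjoin_pow {l : ℕ} (hl : 1 ≤ l) (β : Kbar p k) :
    IsGaloisExt (cycAdjoin_pow_le l p β) :=
  isGaloisExt_of_map_mem _ fun σ hσ _ hx => map_mem_cycAdjoin σ l
    (map_root_mem_cycAdjoin σ hl (by rw [pow_one]; exact hσ _ (self_mem_cycAdjoin l _))) hx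

theorem isGaloisExt_cyc_cycAdjoin {l c : ℕ} (hlc : l ≤ c) {β : Kbar p k}
    (hβ : β ^ p ^ c ∈ cyc p k l) : IsGaloisExt (cyc_le_cycAdjoin_of_le hlc β) :=
  isGaloisExt_of_map_mem _ fun σ hσ _ hx => map_mem_cycAdjoin σ c
    (map_root_mem_cycAdjoin σ le_rfl (hσ _ hβ)) hx

theorem eq_of_mem_cycAdjoin {n : ℕ} {β : Kbar p k} (σ : Kbar p k ≃ₐ[K0 p k] Kbar p k)
    (hσ : ∀ x ∈ cyc p k n, σ x = x) (hβ : σ β = β) {x : Kbar p k}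
    (hx : x ∈ cycAdjoin p k n β) : σ x = x :=
  (cycAdjoin_le_iff (E := FixedBy.intermediateField (K0 p k) (Kbar p k) σ)).2 ⟨hσ, hβ⟩ hx

section Tower

variable {B E : IntermediateField (K0 p k) (Kbar p k)} [Algebra B E] [IsScalarTower B E (Kbar p k)]

theorem coe_algebraMap (x : B) : ((algebraMap B E x : E) : Kbar p k) = x :=
  (IsScalarTower.algebraMap_apply B E (Kbar p k) x).symm

theorem map_eq_of_coe_mem (g : E ≃ₐ[B] E) {x : E} (hx : (x : Kbar p k) ∈ B) : g x = x := by
  rw [← (Subtype.ext (coe_algebraMap _) : algebraMap B E ⟨x, hx⟩ = x), g.commutes]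

theorem isScalarTower_K0 : IsScalarTower (K0 p k) B E :=
  IsScalarTower.of_algebraMap_eq fun x =>
    Subtype.ext (coe_algebraMap (algebraMap (K0 p k) B x)).symm

theorem isScalarTower_witt : IsScalarTower (WittVector p k) B E :=
  IsScalarTower.of_algebraMap_eq fun x =>
    Subtype.ext (coe_algebraMap (algebraMap (WittVector p k) B x)).symm

theorem exists_lift (g : E ≃ₐ[B] E) : ∃ σ : Kbar p k ≃ₐ[K0 p k] Kbar p k,
    (∀ x ∈ B, σ x = x) ∧ ∀ x : E, σ x = g x := by
  have := isScalarTower_K0 (B := B) (E := E)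
  refine ⟨(g.restrictScalars (K0 p k)).liftNormal (Kbar p k), fun x hx => ?_, fun x => ?_⟩
  · have := (g.restrictScalars (K0 p k)).liftNormal_commutes (Kbar p k) (algebraMap B E ⟨x, hx⟩)
    simpa [coe_algebraMap] using this
  · exact (g.restrictScalars (K0 p k)).liftNormal_commutes (Kbar p k) x

theorem finiteDimensional_of_tower [FiniteDimensional (K0 p k) E] :
    @FiniteDimensional B E _ _ Algebra.toModule :=
  letI : Module B E := Algebra.toModule
  have := isScalarTower_K0 (B := B) (E := E)
  FiniteDimensional.right (K0 p k) B E

theorem mem_cycAdjoin_of_fixed {n : ℕ} {β : E} [FiniteDimensional (K0 p k) E] [IsGalois B E]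
    (hB : B ≤ cycAdjoin p k n β) (x : E) (hx : ∀ g : E ≃ₐ[B] E, g β = β → g x = x) :
    (x : Kbar p k) ∈ cycAdjoin p k n β := by
  have := finiteDimensional_of_tower (B := B) (E := E)
  have hmem : x ∈ adjoin B {β} := by
    rw [← IsGalois.fixedField_fixingSubgroup (adjoin B {β}), mem_fixedField_iff]
    exact fun g hg => hx g ((mem_fixingSubgroup_iff _ _).1 hg β (mem_adjoin_simple_self B β))
  exact (adjoin_simple_le_iff
    (K := (extendScalars hB).comap (IsScalarTower.toAlgHom B E (Kbar p k)))).2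
    (self_mem_cycAdjoin n _) hmem

end Tower

end GaloisExt

/-! ### The Kummer tower -/

section Kummer

theorem totient_prime_pow_mul_self {p l : ℕ} (hp : p.Prime) (hl : l ≠ 0) :
    (p ^ l).totient * p = (p - 1) * p ^ l := by
  obtain ⟨m, rfl⟩ := Nat.exists_eq_succ_of_ne_zero hl
  rw [Nat.totient_prime_pow_succ hp, pow_succ]
  ring

theorem totient_prime_pow_mul_pow_pos {p : ℕ} (hp : p.Prime) (l j : ℕ) :
    0 < (p ^ l).totient * p ^ j :=
  Nat.mul_pos (Nat.totient_pos.2 (pow_pos hp.pos l)) (pow_pos hp.pos j)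

/- Bézout: if `N r = 1 + p t`, then `s ^ r / π ^ t` has valuation `1`. -/
theorem exists_abs_pow_div_pow_eq {L : Type*} [Field L] (w : AbsoluteValue L ℝ) {s π : L} {q : ℝ}
    (hq : q ≠ 0) {e p N : ℕ} (hp : p.Prime) (hs : w s ^ (e * p) = q ^ N) (hπ : w π ^ e = q)
    (hN : ¬ p ∣ N) : ∃ r t : ℕ, ¬ p ∣ r ∧ w (s ^ r / π ^ t) ^ (e * p) = q := by
  obtain ⟨r, -, hr⟩ := Nat.exists_mul_mod_eq_one_of_coprime
    (hp.coprime_iff_not_dvd.2 hN).symm hp.one_lt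
  have hrt : N * r = 1 + p * (N * r / p) := by
    have := Nat.mod_add_div (N * r) p
    rwa [hr, eq_comm] at this
  refine ⟨r, N * r / p, fun hpr => ?_, ?_⟩
  · rw [Nat.mod_eq_zero_of_dvd (hpr.mul_left N)] at hr
    exact zero_ne_one hr
  · have hsr : (w s ^ r) ^ (e * p) = q ^ (1 + p * (N * r / p)) := by
      rw [pow_right_comm, hs, ← pow_mul, ← hrt]
    have hπt : (w π ^ (N * r / p)) ^ (e * p) = q ^ (p * (N * r / p)) := by
      rw [pow_right_comm, pow_mul, hπ, pow_mul]
    rw [map_div₀, map_pow, map_pow, div_pow, hsr, hπt, pow_add, pow_one,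
      mul_div_cancel_right₀ _ (pow_ne_zero _ hq)]

/-- The shape of a `p`-primitive element `a` of `K_l`, `l ≥ 1`, of nonnegative valuation:
`N = v_l(a - δ)` is prime to `p`, where `δ = 1` if `a` is a unit, and `δ = 0` otherwise.
In both cases `v_l(a - 1) = δ N`. -/
structure IsPrimitiveShape (p l δ N : ℕ) : Prop where
  level_ne_zero : l ≠ 0
  le_one : δ ≤ 1
  not_dvd : ¬ p ∣ N
  mul_lt : δ * N < p ^ l

variable {p : ℕ} [Fact p.Prime] {k : Type*} [Field k] [CharP k p]

/-- The arithmetic of a `p ^ j`-th root `β` of a `p`-primitive element `a` of `K_l`: the extension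
`K_l(β) / K_l` is totally ramified of degree `p ^ j`, and in terms of its normalized valuation
`v(β - δ) = N` and `v(β) = N - δ N` with `N` and `δ` as in `IsPrimitiveShape`. -/
structure KummerLevel (w : AbsoluteValue (Kbar p k) ℝ) (l δ N j : ℕ) (β : Kbar p k) : Prop where
  finrank_eq : Module.finrank (K0 p k) (cycAdjoin p k l β) = (p ^ l).totient * p ^ j
  abs_sub : w (β - δ) ^ ((p ^ l).totient * p ^ j) = w p ^ N
  abs_mul : w β ^ ((p ^ l).totient * p ^ j) * w p ^ (δ * N) = w p ^ N
  exists_uniformizer : ∃ π ∈ cycAdjoin p k l β, w π ^ ((p ^ l).totient * p ^ j) = w p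

namespace KummerLevel

variable {w : AbsoluteValue (Kbar p k) ℝ} {l δ N j : ℕ} {β : Kbar p k}

theorem abs_sub_pow (hw : IsPadicAbs w) (hS : IsPrimitiveShape p l δ N)
    (hβ : KummerLevel w l δ N j (β ^ p)) : w (β - δ) ^ p = w (β ^ p - δ) := by
  have hp : p.Prime := Fact.out
  have he := totient_prime_pow_mul_pow_pos hp l j
  obtain rfl | rfl : δ = 0 ∨ δ = 1 := Nat.le_one_iff_eq_zero_or_eq_one.1 hS.le_one
  · simp
  have hβ1 : w β ≤ 1 := by
    have hunit : w (β ^ p) ^ ((p ^ l).totient * p ^ j) = 1 :=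
      mul_right_cancel₀ (pow_ne_zero (1 * N) hw.pos.ne') (by rw [hβ.abs_mul, one_mul, one_mul])
    rw [map_pow, ← pow_mul] at hunit
    exact ((pow_eq_one_iff_of_nonneg (w.nonneg _) (Nat.mul_pos hp.pos he).ne').1 hunit).le
  rw [Nat.cast_one]
  refine hw.abs_sub_one_pow hβ1 (lt_of_pow_lt_pow_left₀ ((p ^ l).totient * p ^ j)
    (pow_nonneg (w.nonneg _) _) ?_)
  have habs := hβ.abs_sub
  rw [Nat.cast_one] at habs
  rw [pow_right_comm (w (β ^ p - 1)), habs, ← pow_mul, ← pow_mul,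
    pow_lt_pow_iff_right_of_lt_one₀ hw.pos hw.lt_one]
  calc N * (p - 1) < p ^ l * (p - 1) :=
        Nat.mul_lt_mul_of_pos_right (by simpa using hS.mul_lt) (Nat.sub_pos_of_lt hp.one_lt)
    _ = (p ^ l).totient * p * 1 := by
        rw [totient_prime_pow_mul_self hp hS.level_ne_zero, mul_comm, mul_one]
    _ ≤ (p ^ l).totient * p * p ^ j := Nat.mul_le_mul_left _ (pow_pos hp.pos j)
    _ = p * ((p ^ l).totient * p ^ j) := by ring

theorem abs_sub_pow_mul (hw : IsPadicAbs w) (hS : IsPrimitiveShape p l δ N)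
    (hβ : KummerLevel w l δ N j (β ^ p)) :
    w (β - δ) ^ ((p ^ l).totient * p ^ j * p) = w p ^ N := by
  rw [mul_comm, pow_mul, hβ.abs_sub_pow hw hS, hβ.abs_sub]

theorem abs_pow_mul (hβ : KummerLevel w l δ N j (β ^ p)) :
    w β ^ ((p ^ l).totient * p ^ j * p) * w p ^ (δ * N) = w p ^ N := by
  rw [mul_comm (_ * _) p, pow_mul, ← map_pow, hβ.abs_mul]

/- The degree is at most `p`; it is exactly `p` since `β - δ` has valuation `N` prime to `p`. -/
theorem finrank_cycAdjoin (hw : IsPadicAbs w) (hS : IsPrimitiveShape p l δ N)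
    (hβ : KummerLevel w l δ N j (β ^ p)) :
    Module.finrank (K0 p k) (cycAdjoin p k l β) = (p ^ l).totient * p ^ j * p := by
  have hp : p.Prime := Fact.out
  have he := totient_prime_pow_mul_pow_pos hp l j
  have hdeg := IntermediateField.finrank_bot_mul_relfinrank (cycAdjoin_pow_le l p β)
  rw [hβ.finrank_eq] at hdeg
  have hdvd := hw.dvd_mul_finrank
    (sub_mem (self_mem_cycAdjoin l β) (natCast_mem (cycAdjoin p k l β) δ))
    (Nat.mul_pos he hp.pos).ne' (hβ.abs_sub_pow_mul hw hS)
  rw [← hdeg, mul_left_comm, Nat.mul_dvd_mul_iff_left he] at hdvd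
  have hpos : 0 < IntermediateField.relfinrank (cycAdjoin p k l (β ^ p)) (cycAdjoin p k l β) :=
    Nat.pos_of_mul_pos_left (hdeg ▸ Module.finrank_pos)
  rw [← hdeg, le_antisymm (relfinrank_cycAdjoin_pow_le l hp.ne_zero β)
    (Nat.le_of_dvd hpos ((hp.dvd_mul.1 hdvd).resolve_left hS.not_dvd))]

theorem abs_sub_one_mul_div (hw : IsPadicAbs w) (hS : IsPrimitiveShape p l δ N)
    (hβ : KummerLevel w l δ N j (β ^ p)) {η : Kbar p k} (hη : η ^ p = 1) (hη1 : η ≠ 1) :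
    w ((η - 1) * β / (β - δ)) ^ ((p ^ l).totient * p ^ j * p) = w p ^ (p ^ (l + j) - δ * N) := by
  have hp : p.Prime := Fact.out
  have hroot : w (η - 1) ^ ((p ^ l).totient * p ^ j * p) = w p ^ p ^ (l + j) := by
    rw [mul_right_comm, totient_prime_pow_mul_self hp hS.level_ne_zero, mul_assoc, ← pow_add,
      pow_mul, hw.abs_root_sub_one hη hη1]
  have hle : δ * N ≤ p ^ (l + j) :=
    hS.mul_lt.le.trans (Nat.pow_le_pow_right hp.pos (Nat.le_add_right l j))
  have hβ0 : w β ^ ((p ^ l).totient * p ^ j * p) ≠ 0 :=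
    left_ne_zero_of_mul (hβ.abs_pow_mul ▸ pow_ne_zero N hw.pos.ne')
  rw [map_div₀, map_mul, div_pow, mul_pow, hroot, hβ.abs_sub_pow_mul hw hS, ← hβ.abs_pow_mul,
    pow_sub₀ _ hw.pos.ne' hle]
  field_simp

/- The uniformizer is `ϖ = s ^ r / π ^ t` with `s = β - δ` and `p ∤ r`. If `σ β = η β`, then
`σ s = s (1 + y)` with `y = (η - 1) β / s`, so `σ ϖ - ϖ = ϖ ((1 + y) ^ r - 1)` has the same
valuation as `ϖ y`. -/
theorem exists_uniformizer_root (hw : IsPadicAbs w) (hS : IsPrimitiveShape p l δ N)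
    (hβ : KummerLevel w l δ N j (β ^ p)) :
    ∃ ϖ ∈ cycAdjoin p k l β, w ϖ ^ ((p ^ l).totient * p ^ j * p) = w p ∧
      ∀ σ : Kbar p k ≃ₐ[K0 p k] Kbar p k, (∀ x ∈ cycAdjoin p k l (β ^ p), σ x = x) → σ β ≠ β →
        w (σ ϖ - ϖ) = w ϖ ^ (p ^ (l + j) - δ * N + 1) := by
  have hp : p.Prime := Fact.out
  have hep : (p ^ l).totient * p ^ j * p ≠ 0 :=
    (Nat.mul_pos (totient_prime_pow_mul_pow_pos hp l j) hp.pos).ne'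
  obtain ⟨π, hπ, hπe⟩ := hβ.exists_uniformizer
  obtain ⟨r, t, hr, hϖ⟩ :=
    exists_abs_pow_div_pow_eq w hw.pos.ne' hp (hβ.abs_sub_pow_mul hw hS) hπe hS.not_dvd
  have hs : β - δ ∈ cycAdjoin p k l β :=
    sub_mem (self_mem_cycAdjoin l β) (natCast_mem (cycAdjoin p k l β) δ)
  have hs0 : β - δ ≠ 0 := fun h0 =>
    pow_ne_zero N hw.pos.ne'
      ((hβ.abs_sub_pow_mul hw hS).symm.trans (by rw [h0, map_zero, zero_pow hep]))
  refine ⟨(β - δ) ^ r / π ^ t, div_mem (pow_mem hs r) (pow_mem (cycAdjoin_pow_le l p β hπ) t), hϖ,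
    fun σ hσ hσβ => ?_⟩
  set ϖ := (β - δ) ^ r / π ^ t with hϖ_def
  have hβ0 : β ≠ 0 := fun h0 => hσβ (by rw [h0, map_zero])
  set y := (σ β / β - 1) * β / (β - δ) with hy
  have hyw : w y = w ϖ ^ (p ^ (l + j) - δ * N) := by
    refine (pow_left_inj₀ (w.nonneg _) (pow_nonneg (w.nonneg _) _) hep).1 ?_
    rw [pow_right_comm, hϖ]
    refine hβ.abs_sub_one_mul_div hw hS ?_ fun h1 => hσβ ((div_eq_one_iff_eq hβ0).1 h1)
    rw [div_pow, ← map_pow, hσ _ (self_mem_cycAdjoin l _), div_self (pow_ne_zero p hβ0)]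
  have hy1 : w y < 1 := by
    rw [hyw]
    have hlt : δ * N < p ^ (l + j) :=
      hS.mul_lt.trans_le (Nat.pow_le_pow_right hp.pos (Nat.le_add_right l j))
    refine pow_lt_one₀ (w.nonneg _) ?_ (Nat.sub_pos_of_lt hlt).ne'
    rw [← pow_lt_one_iff_of_nonneg (w.nonneg _) hep, hϖ]
    exact hw.lt_one
  have hσs : σ β - δ = (β - δ) * (1 + y) := by
    rw [hy]
    field_simp
    ring
  have hσϖ : σ ϖ - ϖ = ϖ * ((1 + y) ^ r - 1) := by
    rw [hϖ_def, map_div₀, map_pow, map_pow, map_sub, map_natCast, hσ π hπ, hσs, mul_pow]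
    ring
  rw [hσϖ, map_mul, hw.abs_one_add_pow_sub_one hw.lt_one hr hy1, hyw, pow_succ']

theorem succ (hw : IsPadicAbs w) (hS : IsPrimitiveShape p l δ N)
    (hβ : KummerLevel w l δ N j (β ^ p)) : KummerLevel w l δ N (j + 1) β := by
  have he : (p ^ l).totient * p ^ (j + 1) = (p ^ l).totient * p ^ j * p := by
    rw [pow_succ, mul_assoc]
  obtain ⟨ϖ, hϖ, hϖe, -⟩ := hβ.exists_uniformizer_root hw hS
  exact ⟨he ▸ hβ.finrank_cycAdjoin hw hS, he ▸ hβ.abs_sub_pow_mul hw hS, he ▸ hβ.abs_pow_mul,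
    ϖ, hϖ, he ▸ hϖe⟩

end KummerLevel

end Kummer

section Primitive

variable {p : ℕ} [Fact p.Prime] {k : Type*} [Field k] [CharP k p]
  {w : AbsoluteValue (Kbar p k) ℝ} {l : ℕ}

theorem IsPadicAbs.cycVal_eq_coe_iff (hw : IsPadicAbs w) (hl : l ≠ 0) (x : cyc p k l) (m : ℤ) :
    cycVal p k l x = m ↔ w x ^ (p ^ l).totient = w p ^ m := by
  obtain ⟨ζ, hζ⟩ := exists_isPrimitiveRoot (p := p) (k := k) l
  let π : cyc p k l := ⟨ζ - 1, sub_mem (mem_cyc_of_pow_eq_one hζ.pow_eq_one) (one_mem _)⟩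
  have hπ : w π ^ (p ^ l).totient = w p := hw.abs_primitiveRoot_sub_one hl hζ
  have hgen : IsValueGen (absRestrict w (cyc p k l)) π :=
    hw.isValueGen_of_pow_eq _ (by rw [hw.finrank_cyc hl, hπ])
  have hpos : (p ^ l).totient ≠ 0 :=
    (Nat.totient_pos.2 (pow_pos (Fact.out : p.Prime).pos l)).ne'
  rw [← hπ, ← zpow_natCast (w π), ← zpow_mul, mul_comm, zpow_mul, zpow_natCast,
    pow_left_inj₀ (w.nonneg _) (zpow_nonneg (w.nonneg _) m) hpos]
  exact (hw.absRestrict _).val_eq_coe_iff hgen x m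

theorem IsPadicAbs.cycVal_prime (hw : IsPadicAbs w) (hl : l ≠ 0) :
    cycVal p k l p = ((p ^ l).totient : ℤ) := by
  rw [hw.cycVal_eq_coe_iff hl, zpow_natCast]
  rfl

theorem KummerLevel.zero (hw : IsPadicAbs w) (hl : l ≠ 0) {a : Kbar p k} (ha : a ∈ cyc p k l)
    {δ N : ℕ} (hsub : w (a - δ) ^ (p ^ l).totient = w p ^ N)
    (hmul : w a ^ (p ^ l).totient * w p ^ (δ * N) = w p ^ N) : KummerLevel w l δ N 0 a := by
  obtain ⟨ζ, hζ⟩ := exists_isPrimitiveRoot (p := p) (k := k) l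
  constructor
  case finrank_eq => rw [cycAdjoin_eq_cyc ha, hw.finrank_cyc hl, pow_zero, mul_one]
  case abs_sub => rwa [pow_zero, mul_one]
  case abs_mul => rwa [pow_zero, mul_one]
  case exists_uniformizer =>
    refine ⟨ζ - 1, sub_mem (cyc_le_cycAdjoin l a (mem_cyc_of_pow_eq_one hζ.pow_eq_one))
      (one_mem _), ?_⟩
    rw [pow_zero, mul_one, hw.abs_primitiveRoot_sub_one hl hζ]

theorem IsPadicAbs.exists_kummerLevel_of_val (hw : IsPadicAbs w) (hl : l ≠ 0) {a : cyc p k l}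
    {N : ℤ} (hN : cycVal p k l a = N) (hpN : ¬ (p : ℤ) ∣ N) (ha0 : 0 ≤ cycVal p k l a) :
    ∃ δ N : ℕ, IsPrimitiveShape p l δ N ∧ cycVal p k l (a - 1) = ((δ * N : ℕ) : ℤ) ∧
      KummerLevel w l δ N 0 (a : Kbar p k) := by
  lift N to ℕ using by rw [hN] at ha0; exact_mod_cast ha0
  rw [Int.natCast_dvd_natCast] at hpN
  rw [hw.cycVal_eq_coe_iff hl, zpow_natCast] at hN
  have hpos : (p ^ l).totient ≠ 0 :=
    (Nat.totient_pos.2 (pow_pos (Fact.out : p.Prime).pos l)).ne'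
  have ha1 : w a < 1 := by
    rw [← pow_lt_one_iff_of_nonneg (w.nonneg _) hpos, hN]
    exact pow_lt_one₀ hw.pos.le hw.lt_one fun h0 => hpN (h0 ▸ dvd_zero p)
  have hsub1 : w ((a - 1 : cyc p k l) : Kbar p k) = 1 := by
    have := abs_one_add_of_lt hw.nonarch (x := -(a : Kbar p k)) (by rwa [w.map_neg])
    rwa [← sub_eq_add_neg, w.map_sub] at this
  refine ⟨0, N, ⟨hl, zero_le_one, hpN, ?_⟩, ?_, .zero hw hl a.2 ?_ ?_⟩
  · rw [zero_mul]
    exact pow_pos (Fact.out : p.Prime).pos l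
  · rw [hw.cycVal_eq_coe_iff hl, hsub1, one_pow, zero_mul, Nat.cast_zero, zpow_zero]
  · rwa [Nat.cast_zero, sub_zero]
  · rw [zero_mul, pow_zero, mul_one, hN]

theorem IsPadicAbs.exists_kummerLevel_of_val_sub_one (hw : IsPadicAbs w) (hl : l ≠ 0)
    {a : cyc p k l} {N : ℤ} (hN : cycVal p k l (a - 1) = N) (hN0 : 0 < N) (hpN : ¬ (p : ℤ) ∣ N)
    (hlt : (N : ℝ) < p / (p - 1) * (p ^ l).totient) :
    ∃ δ N : ℕ, IsPrimitiveShape p l δ N ∧ cycVal p k l (a - 1) = ((δ * N : ℕ) : ℤ) ∧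
      KummerLevel w l δ N 0 (a : Kbar p k) := by
  have hp : p.Prime := Fact.out
  lift N to ℕ using hN0.le
  rw [Int.natCast_dvd_natCast] at hpN
  have hsub : w ((a : Kbar p k) - 1) ^ (p ^ l).totient = w p ^ N := by
    rwa [hw.cycVal_eq_coe_iff hl, zpow_natCast] at hN
  have hlt1 : w ((a : Kbar p k) - 1) < 1 := by
    rw [← pow_lt_one_iff_of_nonneg (w.nonneg _) (Nat.totient_pos.2 (pow_pos hp.pos l)).ne', hsub]
    exact pow_lt_one₀ hw.pos.le hw.lt_one (by exact_mod_cast hN0.ne')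
  have ha1 : w (a : Kbar p k) = 1 := by
    simpa only [add_sub_cancel] using abs_one_add_of_lt hw.nonarch hlt1
  have hNlt : N < p ^ l := by
    have hp1 : (0 : ℝ) < p - 1 := sub_pos.2 (Nat.one_lt_cast.2 hp.one_lt)
    have htot : ((p ^ l).totient * p : ℝ) = (p - 1) * p ^ l := by
      have := congrArg (Nat.cast (R := ℝ)) (totient_prime_pow_mul_self hp hl)
      simpa only [Nat.cast_mul, Nat.cast_pow, Nat.cast_pred hp.pos] using this
    rw [div_mul_eq_mul_div, mul_comm (p : ℝ), htot, mul_div_cancel_left₀ _ hp1.ne'] at hlt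
    exact_mod_cast hlt
  refine ⟨1, N, ⟨hl, le_rfl, hpN, by rwa [one_mul]⟩, by rwa [one_mul], .zero hw hl a.2 ?_ ?_⟩
  · rwa [Nat.cast_one]
  · rw [ha1, one_pow, one_mul, one_mul]

theorem IsPadicAbs.exists_kummerLevel (hw : IsPadicAbs w) (hl : l ≠ 0) {a : cyc p k l}
    (ha : IsPrimitiveElt (WittVector p k) (cyc p k l) p a) (ha0 : 0 ≤ cycVal p k l a) :
    ∃ δ N : ℕ, IsPrimitiveShape p l δ N ∧ cycVal p k l (a - 1) = ((δ * N : ℕ) : ℤ) ∧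
      KummerLevel w l δ N 0 (a : Kbar p k) := by
  rcases ha with ⟨N, hN, hpN⟩ | ⟨N, e, hN, he, hN0, hlt, hpN⟩
  · exact hw.exists_kummerLevel_of_val hl hN hpN ha0
  · obtain rfl : e = (p ^ l).totient := WithTop.coe_injective (he.symm.trans (hw.cycVal_prime hl))
    exact hw.exists_kummerLevel_of_val_sub_one hl hN hN0 hpN (by simpa using hlt)

theorem KummerLevel.root {δ N c : ℕ} {α : Kbar p k} (hw : IsPadicAbs w)
    (hS : IsPrimitiveShape p l δ N) (h0 : KummerLevel w l δ N 0 (α ^ p ^ c)) :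
    ∀ {s j : ℕ}, s + j = c → KummerLevel w l δ N j (α ^ p ^ s) := by
  intro s j
  induction j generalizing s with
  | zero => rintro rfl; exact h0
  | succ j ih =>
    intro hsj
    refine KummerLevel.succ hw hS ?_
    rw [← pow_mul, ← pow_succ]
    exact ih (by omega)

end Primitive

/-! ### The recursion along the Kummer tower -/

section Numeric

theorem pow_le_add_mul_pow_pred {p : ℕ} (hp : 0 < p) (l : ℕ) :
    p ^ l ≤ 1 + (p - 1) * l * p ^ (l - 1) := by
  induction l with
  | zero => simp
  | succ l ih =>
    have hmono : p ^ (l - 1) ≤ p ^ l := Nat.pow_le_pow_right hp (Nat.sub_le l 1)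
    calc p ^ (l + 1) = p ^ l + (p - 1) * p ^ l := by
          rw [← one_add_mul, show 1 + (p - 1) = p by omega, pow_succ']
      _ ≤ 1 + (p - 1) * l * p ^ l + (p - 1) * p ^ l := by gcongr; exact ih.trans (by gcongr)
      _ = 1 + (p - 1) * (l + 1) * p ^ (l + 1 - 1) := by rw [Nat.add_sub_cancel]; ring

variable {ω : ℝ} (hω0 : 0 < ω) (hω1 : ω < 1) {p c : ℕ} (hp : 0 < p) {Z : ℕ → ℝ}
include hω0 hω1 hp

theorem lt_zpow_of_herbrand_recursion {P d : ℤ} (hP : 0 ≤ P)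
    (hstep : ∀ s < c, Z (s + 1) ≤ Z s * max (ω ^ (P - d * (p : ℤ) ^ s)) (Z s) ^ (p - 1))
    (hzero : Z 0 < ω ^ (P - d)) {s : ℕ} (hs : s ≤ c) :
    Z s < ω ^ (P * (1 + ((p : ℤ) - 1) * s) - d * (p : ℤ) ^ s) := by
  have hp1 : (0 : ℤ) ≤ (p : ℤ) - 1 := by omega
  induction s with
  | zero => simpa using hzero
  | succ s ih =>
    have hlt := ih (by omega)
    set b : ℤ := P - d * (p : ℤ) ^ s with hb
    have hle : Z s ≤ ω ^ b := by
      refine hlt.le.trans (zpow_le_zpow_right_of_le_one₀ hω0 hω1.le ?_)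
      have : 0 ≤ P * (((p : ℤ) - 1) * s) := by positivity
      linarith
    calc Z (s + 1) ≤ Z s * max (ω ^ b) (Z s) ^ (p - 1) := hstep s (by omega)
      _ = Z s * (ω ^ b) ^ (p - 1) := by rw [max_eq_left hle]
      _ < ω ^ (P * (1 + ((p : ℤ) - 1) * s) - d * (p : ℤ) ^ s) * (ω ^ b) ^ (p - 1) :=
        mul_lt_mul_of_pos_right hlt (pow_pos (zpow_pos hω0 b) _)
      _ = ω ^ (P * (1 + ((p : ℤ) - 1) * ↑(s + 1)) - d * (p : ℤ) ^ (s + 1)) := by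
        rw [← zpow_natCast (ω ^ b), ← zpow_mul, ← zpow_add₀ hω0.ne', Nat.cast_pred hp, hb]
        push_cast
        ring_nf

theorem zpow_le_of_herbrand_recursion {l n : ℕ} (hl : l ≠ 0) (hlc : l ≤ c) (hn : n < p ^ l)
    (hstep : ∀ s < c, Z (s + 1) ≤
      Z s * max (ω ^ ((p : ℤ) ^ (c + l - 1) - ((n : ℤ) - 1) * (p : ℤ) ^ s)) (Z s) ^ (p - 1))
    (hlast : ω ^ (p ^ (c + l - 1) * ((p - 1) * (c - l) + 1)) ≤ Z c) :
    ω ^ ((p : ℤ) ^ (c + l - 1) - ((n : ℤ) - 1)) ≤ Z 0 := by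
  by_contra! hcon
  have hlt := lt_zpow_of_herbrand_recursion hω0 hω1 hp (by positivity) hstep hcon le_rfl
  rw [← zpow_natCast] at hlast
  have hexp := (zpow_lt_zpow_iff_right_of_lt_one₀ hω0 hω1).1 (hlast.trans_lt hlt)
  have hpow : ((p ^ l : ℕ) : ℤ) ≤ ((1 + (p - 1) * l * p ^ (l - 1) : ℕ) : ℤ) :=
    Nat.cast_le.2 (pow_le_add_mul_pow_pred hp l)
  push_cast [Nat.cast_pred hp, Nat.cast_sub hlc] at hexp hpow
  have hn' : (n : ℤ) < (p : ℤ) ^ l := by exact_mod_cast hn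
  have hmul : ((n : ℤ) - 1) * (p : ℤ) ^ c ≤ ((p : ℤ) - 1) * l * (p : ℤ) ^ (c + l - 1) := by
    calc ((n : ℤ) - 1) * (p : ℤ) ^ c ≤ ((p : ℤ) - 1) * l * (p : ℤ) ^ (l - 1) * (p : ℤ) ^ c :=
          mul_le_mul_of_nonneg_right (by linarith [hn']) (by positivity)
      _ = ((p : ℤ) - 1) * l * (p : ℤ) ^ (c + l - 1) := by
        rw [mul_assoc, ← pow_add, show l - 1 + c = c + l - 1 by omega]
  linarith

end Numeric

/-! ### Ramification in the Kummer tower -/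

section RootOfUnity

variable {A M L : Type*} [CommRing A] [Field M] [Field L] [Algebra A M] [Algebra A L] [Algebra M L]
  [IsScalarTower A M L] {w : AbsoluteValue L ℝ} {ϖ : L}

theorem IsMonogenic.abs_natCast_mul_abs_map_sub_le (hϖ : IsMonogenic A w ϖ)
    [Fintype (L ≃ₐ[M] L)] {m n : ℕ} (hm : m ≠ 0) (hn : n ≠ 0) {ζ : L}
    (hζ : IsPrimitiveRoot ζ (n * m)) (hfix : ∀ g : L ≃ₐ[M] L, g (ζ ^ n) = ζ ^ n)
    (g : L ≃ₐ[M] L) :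
    w n * w (g ζ - ζ) ≤ ∏ h : L ≃ₐ[M] L, max (w (h ϖ - ϖ)) (w (g ϖ - ϖ)) := by
  classical
  have hnm : n * m ≠ 0 := Nat.mul_ne_zero hn hm
  have hwζ : w ζ = 1 := abs_eq_one_of_pow_eq_one w hnm hζ.pow_eq_one
  have hζ0 : ζ ≠ 0 := hζ.ne_zero hnm
  refine le_trans ?_ (hϖ.prod_conj_mul_le hwζ.le g)
  refine mul_le_mul_of_nonneg_right ?_ (w.nonneg _)
  set S := (univ.image fun h : L ≃ₐ[M] L => h ζ).erase ζ
  have hroots : ∀ η ∈ S.image (· / ζ), η ^ n = 1 ∧ η ≠ 1 := by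
    intro η hη
    obtain ⟨x, hx, rfl⟩ := mem_image.1 hη
    obtain ⟨hxζ, hx⟩ := mem_erase.1 hx
    obtain ⟨h, -, rfl⟩ := mem_image.1 hx
    exact ⟨by rw [div_pow, ← map_pow, hfix, div_self (pow_ne_zero n hζ0)],
      fun h1 => hxζ ((div_eq_one_iff_eq hζ0).1 h1)⟩
  calc w n ≤ ∏ η ∈ S.image (· / ζ), w (η - 1) :=
        hϖ.abs_natCast_le_prod_root_sub_one hn
          (hζ.pow (Nat.pos_of_ne_zero hnm) (Nat.mul_comm n m)) _ hroots
    _ = ∏ η ∈ S, w (η - ζ) := by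
        rw [prod_image fun x _ y _ hxy => (div_left_inj' hζ0).1 hxy]
        refine prod_congr rfl fun x _ => ?_
        rw [div_sub_one hζ0, map_div₀, hwζ, div_one]

end RootOfUnity

theorem KummerLevel.exists_map_ne {p : ℕ} [Fact p.Prime] {k : Type*} [Field k] [CharP k p]
    {w : AbsoluteValue (Kbar p k) ℝ} (hw : IsPadicAbs w) {l δ N j : ℕ}
    (hS : IsPrimitiveShape p l δ N) {B E : IntermediateField (K0 p k) (Kbar p k)} [Algebra B E]
    [IsScalarTower B E (Kbar p k)] [FiniteDimensional (K0 p k) E] [IsGalois B E] {β : E}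
    (hβ : KummerLevel w l δ N j ((β : Kbar p k) ^ p))
    (hB : B ≤ cycAdjoin p k l ((β : Kbar p k) ^ p)) :
    ∃ σ : E ≃ₐ[B] E, σ (β ^ p) = β ^ p ∧ σ β ≠ β := by
  have hp : p.Prime := Fact.out
  by_contra! hcon
  have hmem : (β : Kbar p k) ∈ cycAdjoin p k l ((β : Kbar p k) ^ p) :=
    mem_cycAdjoin_of_fixed (β := β ^ p) hB β hcon
  have hdeg := hβ.finrank_cycAdjoin hw hS
  rw [← le_antisymm (cycAdjoin_pow_le l p _) (cycAdjoin_le le_rfl hmem), hβ.finrank_eq,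
    eq_comm, Nat.mul_eq_left (totient_prime_pow_mul_pow_pos hp l j).ne'] at hdeg
  exact hp.one_lt.ne' hdeg

section HerbrandStep

open IntermediateField MulAction

variable {p : ℕ} [Fact p.Prime] {k : Type*} [Field k] [CharP k p]
  {w : AbsoluteValue (Kbar p k) ℝ} {l δ N : ℕ}
  {E : IntermediateField (K0 p k) (Kbar p k)}
  [Algebra (cyc p k l) E] [IsScalarTower (cyc p k l) E (Kbar p k)]

theorem pow_map_ne_of_map_pow_eq (hl : l ≠ 0) {σ : E ≃ₐ[cyc p k l] E} {β : E}
    (hσ : σ (β ^ p) = β ^ p) (hσβ : σ β ≠ β) {i : ℕ} (hi0 : 0 < i) (hip : i < p) :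
    (σ ^ i) β ≠ β := by
  have hβ0 : β ≠ 0 := fun h0 => hσβ (by rw [h0, map_zero])
  have hηp : (σ β / β) ^ p = 1 := by
    rw [div_pow, ← map_pow, hσ, div_self (pow_ne_zero p hβ0)]
  have hη1 : σ β / β ≠ 1 := fun h1 => hσβ ((div_eq_one_iff_eq hβ0).1 h1)
  have hfix : σ (σ β / β) = σ β / β := map_eq_of_coe_mem σ <| mem_cyc_of_pow_eq_one <| by
    rw [← mul_pow_sub_one hl, pow_mul, ← SubmonoidClass.coe_pow, hηp, OneMemClass.coe_one, one_pow]
  have hiter : ∀ i, (σ ^ i) β = (σ β / β) ^ i * β := by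
    intro i
    induction i with
    | zero => rw [pow_zero, pow_zero, one_mul, AlgEquiv.one_apply]
    | succ i ih =>
      rw [pow_succ', AlgEquiv.mul_apply, ih, map_mul, map_pow, hfix, pow_succ, mul_assoc,
        div_mul_cancel₀ _ hβ0]
  rw [hiter, ne_eq, mul_eq_right₀ hβ0, ← orderOf_dvd_iff_pow_eq_one, orderOf_eq_prime hηp hη1]
  exact Nat.not_dvd_of_pos_of_lt hi0 hip

variable [FiniteDimensional (K0 p k) E]

theorem pow_mul_le_prod_of_map_ne [IsAlgClosed k] [Fintype (E ≃ₐ[cyc p k l] E)]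
    (hw : IsPadicAbs w) {c : ℕ} (hlc : l ≤ c) {ζ : E} (hζ : IsPrimitiveRoot ζ (p ^ c)) {ϖ : E}
    (hϖ : IsValueGen (absRestrict w E) ϖ) {g : E ≃ₐ[cyc p k l] E} (hg : g ζ ≠ ζ) {ρ : ℝ}
    (hρ : ρ ^ (p - 1) = w p) :
    w p ^ (c - l) * ρ ≤
      ∏ h : E ≃ₐ[cyc p k l] E, max (w (h ϖ - ϖ : E)) (w (g ϖ - ϖ : E)) := by
  have hp : p.Prime := Fact.out
  have := isScalarTower_witt (B := cyc p k l) (E := E)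
  have hfix : ∀ h : E ≃ₐ[cyc p k l] E, h (ζ ^ p ^ (c - l)) = ζ ^ p ^ (c - l) := fun h =>
    map_eq_of_coe_mem h <| mem_cyc_of_pow_eq_one <| by
      rw [← SubmonoidClass.coe_pow, ← pow_mul, ← pow_add, Nat.sub_add_cancel hlc, hζ.pow_eq_one,
        OneMemClass.coe_one]
  have hζ0 : ζ ≠ 0 := hζ.ne_zero (pow_ne_zero c hp.ne_zero)
  have hwζ : absRestrict w E ζ = 1 :=
    abs_eq_one_of_pow_eq_one _ (pow_ne_zero c hp.ne_zero) hζ.pow_eq_one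
  have hroot : w p ≤ absRestrict w E (g ζ / ζ - 1) ^ (p - 1) :=
    (hw.absRestrict E).le_abs_root_sub_one_pow (n := c - l)
      (by rw [div_pow, ← map_pow, hfix, div_self (pow_ne_zero _ hζ0)])
      fun h1 => hg ((div_eq_one_iff_eq hζ0).1 h1)
  rw [div_sub_one hζ0, map_div₀, hwζ, div_one, ← hρ] at hroot
  have hle := (hw.isMonogenic hϖ).abs_natCast_mul_abs_map_sub_le
    (pow_ne_zero l hp.ne_zero) (pow_ne_zero (c - l) hp.ne_zero)
    (by rwa [← pow_add, Nat.sub_add_cancel hlc]) hfix g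
  rw [Nat.cast_pow, map_pow] at hle
  exact (mul_le_mul_of_nonneg_left (le_of_pow_le_pow_left₀ (Nat.sub_pos_of_lt hp.one_lt).ne'
    (AbsoluteValue.nonneg _ _) hroot) (pow_nonneg (w.nonneg _) _)).trans hle

variable [IsGalois (cyc p k l) E]

theorem KummerLevel.abs_map_sub_le [IsAlgClosed k] (hw : IsPadicAbs w)
    (hS : IsPrimitiveShape p l δ N)
    {j : ℕ} {β : E} (hβ : KummerLevel w l δ N j ((β : Kbar p k) ^ p))
    {ρ : ℝ} (hρ0 : 0 ≤ ρ) (hρ : ρ ^ ((p ^ l).totient * p ^ j * p) = w p)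
    {σ : E ≃ₐ[cyc p k l] E} (hσ : σ (β ^ p) = β ^ p) (hσβ : σ β ≠ β)
    {x : E} (hx : ∀ h ∈ stabilizer (E ≃ₐ[cyc p k l] E) β, h x = x) (hx1 : w x ≤ 1) :
    w (σ x - x : E) ≤ ρ ^ (p ^ (l + j) - δ * N + 1) := by
  obtain ⟨π, hπ, hπe, hdiff⟩ := hβ.exists_uniformizer_root hw hS
  obtain rfl : w π = ρ := (pow_left_inj₀ (w.nonneg π) hρ0
    (Nat.mul_pos (totient_prime_pow_mul_pow_pos Fact.out l j) (Fact.out : p.Prime).pos).ne').1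
      (hπe.trans hρ.symm)
  obtain ⟨τ, hτB, hτ⟩ := exists_lift σ
  have hτβ : τ ((β : Kbar p k) ^ p) = (β : Kbar p k) ^ p := by
    simpa only [SubmonoidClass.coe_pow, hσ] using hτ (β ^ p)
  rw [← hdiff τ (fun y hy => eq_of_mem_cycAdjoin τ hτB hτβ hy)
    fun h => hσβ (Subtype.ext ((hτ β).symm.trans h))]
  have hgen := hw.isMonogenic (hw.isValueGen_of_pow_eq (cycAdjoin p k l (β : Kbar p k))
    (ϖ := ⟨π, hπ⟩) (by rw [hβ.finrank_cycAdjoin hw hS]; exact hπe))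
  obtain ⟨P, hP⟩ := hgen.exists_aeval
    ⟨x, mem_cycAdjoin_of_fixed (cyc_le_cycAdjoin l _) x fun g hg => hx g hg⟩ hx1
  have hPx : aeval π P = (x : Kbar p k) :=
    (aeval_coe _ (⟨π, hπ⟩ : cycAdjoin p k l (β : Kbar p k)) P).trans (congrArg Subtype.val hP)
  have hπ1 : w π ≤ 1 := hgen.lt_one.le
  rw [AddSubgroupClass.coe_sub, ← hτ, ← hPx, algEquiv_aeval]
  exact hw.abs_aeval_sub_le ((hw.map_le_one_iff τ π).2 hπ1) hπ1 P

theorem KummerLevel.ramProd_stabilizer_pow_le [IsAlgClosed k] [Fintype (E ≃ₐ[cyc p k l] E)]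
    [DecidableEq E] (hw : IsPadicAbs w) (hS : IsPrimitiveShape p l δ N) {j : ℕ} {β : E}
    (hβ : KummerLevel w l δ N j ((β : Kbar p k) ^ p)) {ρ : ℝ} (hρ0 : 0 ≤ ρ)
    (hρ : ρ ^ ((p ^ l).totient * p ^ j * p) = w p) {ϖ : E} (hϖ : IsValueGen (absRestrict w E) ϖ)
    {r : ℝ} (hr : r ≤ 1) :
    ramProd (absRestrict w E) ϖ (stabilizer (E ≃ₐ[cyc p k l] E) (β ^ p)) r ≤
      ramProd (absRestrict w E) ϖ (stabilizer (E ≃ₐ[cyc p k l] E) β) r *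
        max (ρ ^ (p ^ (l + j) - δ * N + 1))
          (ramProd (absRestrict w E) ϖ (stabilizer (E ≃ₐ[cyc p k l] E) β) r) ^ (p - 1) := by
  have := isScalarTower_witt (B := cyc p k l) (E := E)
  obtain ⟨σ, hσ, hσβ⟩ := hβ.exists_map_ne hw hS (B := cyc p k l) (cyc_le_cycAdjoin l _)
  refine ramProd_le_mul (hw.absRestrict E) hϖ (fun g hg => ?_) hσ (Fact.out : p.Prime).pos
    (fun i => pow_map_ne_of_map_pow_eq hS.level_ne_zero hσ hσβ)
    (fun x => hβ.abs_map_sub_le hw hS hρ0 hρ hσ hσβ) hr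
  rw [mem_stabilizer_iff] at hg ⊢
  rw [smul_pow', hg]

end HerbrandStep

section HerbrandBound

open IntermediateField MulAction

variable {p : ℕ} [Fact p.Prime] {k : Type*} [Field k] [CharP k p]
  {w : AbsoluteValue (Kbar p k) ℝ} {l δ N c : ℕ}
  {E : IntermediateField (K0 p k) (Kbar p k)}
  [Algebra (cyc p k l) E] [IsScalarTower (cyc p k l) E (Kbar p k)]

theorem eq_one_of_map_eq {ζ α : E} (hζ : IsPrimitiveRoot (ζ : Kbar p k) (p ^ c))
    (hE : E ≤ cycAdjoin p k c α) {g : E ≃ₐ[cyc p k l] E} (hgζ : g ζ = ζ) (hgα : g α = α) :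
    g = 1 := by
  obtain ⟨τ, -, hτ⟩ := exists_lift g
  refine AlgEquiv.ext fun x => Subtype.ext ?_
  rw [← hτ]
  refine eq_of_mem_cycAdjoin τ ?_ (by rw [hτ, hgα]) (hE x.2)
  rw [cyc_eq_adjoin hζ]
  exact adjoin_simple_le_iff (K := FixedBy.intermediateField (K0 p k) (Kbar p k) τ).2
    (show τ ζ = ζ by rw [hτ, hgζ])

variable [FiniteDimensional (K0 p k) E] [Fintype (E ≃ₐ[cyc p k l] E)] [IsAlgClosed k]

theorem pow_le_prod_of_map_eq (hw : IsPadicAbs w) (hl : l ≠ 0) (hlc : l ≤ c) {α : E}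
    (hE : E = cycAdjoin p k c α) {ϖ : E} (hϖ : IsValueGen (absRestrict w E) ϖ)
    {g : E ≃ₐ[cyc p k l] E} (hg : g ≠ 1) (hgα : g α = α) {ω : ℝ}
    (hω : ω ^ ((p ^ l).totient * p ^ c) = w p) :
    ω ^ (p ^ (c + l - 1) * ((p - 1) * (c - l) + 1)) ≤
      ∏ h : E ≃ₐ[cyc p k l] E, max (w (h ϖ - ϖ : E)) (w (g ϖ - ϖ : E)) := by
  have hp : p.Prime := Fact.out
  obtain ⟨ζ, hζ⟩ := exists_isPrimitiveRoot (p := p) (k := k) c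
  have hζE : ζ ∈ E := hE ▸ cyc_le_cycAdjoin c _ (mem_cyc_of_pow_eq_one hζ.pow_eq_one)
  have hexp : (p ^ l).totient * p ^ c = p ^ (c + l - 1) * (p - 1) := by
    refine Nat.eq_of_mul_eq_mul_right hp.pos ?_
    rw [mul_right_comm, totient_prime_pow_mul_self hp hl, mul_assoc, ← pow_add, mul_right_comm,
      ← pow_succ, show c + l - 1 + 1 = l + c by omega, mul_comm]
  have hle := pow_mul_le_prod_of_map_ne hw hlc (ζ := ⟨ζ, hζE⟩)
    (.of_map_of_injective (f := E.val) hζ E.val.injective) hϖ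
    (fun hgζ => hg (eq_one_of_map_eq hζ hE.le hgζ hgα)) (by rw [← pow_mul, ← hexp, hω])
  rwa [← hω, hexp, ← pow_mul, ← pow_add, mul_assoc, ← mul_add_one] at hle

theorem pow_pow_eq_zpow (ω : ℝ) {p n : ℕ} {s m : ℕ} (hn : n ≤ p ^ m) :
    (ω ^ p ^ s) ^ (p ^ m - n + 1) = ω ^ ((p : ℤ) ^ (s + m) - ((n : ℤ) - 1) * (p : ℤ) ^ s) := by
  rw [← pow_mul, ← zpow_natCast]
  push_cast [Nat.cast_sub hn]
  ring_nf

theorem pow_le_ramProd_stabilizer [IsGalois (cyc p k l) E] [DecidableEq E]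
    (hw : IsPadicAbs w) (hS : IsPrimitiveShape p l δ N) (hlc : l ≤ c) {α : E}
    (hα : (α : Kbar p k) ^ p ^ c ∈ cyc p k l)
    (h0 : KummerLevel w l δ N 0 ((α : Kbar p k) ^ p ^ c))
    (hE : E = cycAdjoin p k c α) {ϖ : E} (hϖ : IsValueGen (absRestrict w E) ϖ)
    {g : E ≃ₐ[cyc p k l] E} (hg : g ≠ 1) (hgα : g α = α) {ω : ℝ} (hω0 : 0 ≤ ω)
    (hω : ω ^ ((p ^ l).totient * p ^ c) = w p) :
    ω ^ (p ^ (c + l - 1) - δ * N + 1) ≤ ramProd (absRestrict w E) ϖ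
      (stabilizer (E ≃ₐ[cyc p k l] E) α) (w (g ϖ - ϖ : E)) := by
  have hp : p.Prime := Fact.out
  have he := (totient_prime_pow_mul_pow_pos hp l c).ne'
  have hωpos : 0 < ω := hω0.lt_of_ne' fun h => hw.pos.ne' (by rw [← hω, h, zero_pow he])
  have hω1 : ω < 1 := (pow_lt_one_iff_of_nonneg hω0 he).1 (hω ▸ hw.lt_one)
  have hle : ∀ j, δ * N ≤ p ^ (l + j) := fun j =>
    hS.mul_lt.le.trans (Nat.pow_le_pow_right hp.pos (Nat.le_add_right l j))
  have hr : w (g ϖ - ϖ : E) ≤ 1 := by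
    have := isScalarTower_witt (B := cyc p k l) (E := E)
    exact ((hw.absRestrict E).abs_map_sub_le_self hϖ g ϖ).trans hϖ.lt_one.le
  have hrec := zpow_le_of_herbrand_recursion hωpos hω1 hp.pos (c := c) (n := δ * N)
    (Z := fun s => ramProd (absRestrict w E) ϖ
      (stabilizer (E ≃ₐ[cyc p k l] E) (α ^ p ^ s)) (w (g ϖ - ϖ : E)))
    hS.level_ne_zero hlc hS.mul_lt ?_ ?_
  · have hzpow := pow_pow_eq_zpow ω (s := 0) (hle (c - 1))
    simp only [pow_zero, pow_one, mul_one, zero_add] at hzpow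
    rw [pow_zero, pow_one] at hrec
    rw [show l + (c - 1) = c + l - 1 by have := hS.level_ne_zero; omega] at hzpow
    rwa [hzpow]
  · intro s hs
    obtain ⟨j, rfl⟩ := Nat.exists_eq_add_of_lt hs
    have hlev : KummerLevel w l δ N j (((α ^ p ^ s : E) : Kbar p k) ^ p) := by
      rw [SubmonoidClass.coe_pow, ← pow_mul, ← pow_succ]
      exact h0.root hw hS (by omega)
    have hstep := hlev.ramProd_stabilizer_pow_le hw hS (pow_nonneg hω0 (p ^ s))
      (by rw [← hω, ← pow_mul]; ring_nf) hϖ hr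
    rwa [pow_pow_eq_zpow ω (hle j), ← pow_mul, ← pow_succ,
      show s + (l + j) = s + j + 1 + l - 1 by omega] at hstep
  · have htop : stabilizer (E ≃ₐ[cyc p k l] E) (α ^ p ^ c) = ⊤ :=
      eq_top_iff.2 fun h _ => map_eq_of_coe_mem h hα
    rw [ramProd_of_eq_top htop]
    exact pow_le_prod_of_map_eq hw hS.level_ne_zero hlc hE hϖ hg hgα hω

end HerbrandBound

/-! ### The conductors in the Kummer tower -/

theorem ramProd_stabilizer_le_prod {B M L : Type*} [Field B] [Field M] [Field L] [Algebra B M]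
    [Algebra M L] [Algebra B L] [IsScalarTower B M L] [DecidableEq L] [Fintype (L ≃ₐ[B] L)]
    [Fintype (L ≃ₐ[M] L)] {w : AbsoluteValue L ℝ} {ϖ α : L}
    (hw : ∀ g : L ≃ₐ[B] L, w (g ϖ - ϖ) ≤ 1) (hα : ∀ h : L ≃ₐ[M] L, h α = α) {r : ℝ}
    (hr : r ≤ 1) :
    ramProd w ϖ (MulAction.stabilizer (L ≃ₐ[B] L) α) r ≤
      ∏ h : L ≃ₐ[M] L, max (w (h ϖ - ϖ)) r := by
  let φ (h : L ≃ₐ[M] L) : MulAction.stabilizer (L ≃ₐ[B] L) α := ⟨h.restrictScalars B, hα h⟩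
  have hφ : Function.Injective φ := fun h h' hh =>
    AlgEquiv.restrictScalars_injective B (congrArg Subtype.val hh)
  exact prod_le_prod_comp_of_injective (fun _ => (w.nonneg _).trans (le_max_left _ _))
    (fun _ => max_le (hw _) hr) hφ

section Conductor

open IntermediateField

variable {p : ℕ} [Fact p.Prime] {k : Type*} [Field k] [CharP k p]
  {w : AbsoluteValue (Kbar p k) ℝ} {l δ N : ℕ}

theorem IsPadicAbs.pow_card_le (hw : IsPadicAbs w) {M E : IntermediateField (K0 p k) (Kbar p k)}
    [Algebra M E] [IsScalarTower M E (Kbar p k)] [IsGalois M E] [FiniteDimensional (K0 p k) E]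
    {ϖ : E} (hϖ : IsValueGen (absRestrict w E) ϖ) {ω : ℝ} (hω0 : 0 ≤ ω)
    (hω : ω ^ Module.finrank (K0 p k) M = w p) :
    w (ϖ : Kbar p k) ^ Nat.card (E ≃ₐ[M] E) ≤ ω := by
  let _ : Module M E := Algebra.toModule
  have := isScalarTower_K0 (B := M) (E := E)
  have := finiteDimensional_of_tower (B := M) (E := E)
  have hdeg := Module.finrank_mul_finrank (K0 p k) M E
  have hpos : 0 < Module.finrank (K0 p k) E := Module.finrank_pos
  have hM : Module.finrank (K0 p k) M ≠ 0 := left_ne_zero_of_mul (hdeg.trans_ne hpos.ne')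
  obtain ⟨z, hz⟩ := hw.exists_zpow E ϖ ϖ.2 (by simpa using hϖ.ne_zero)
  have hz1 : 1 ≤ z := by
    rw [Order.one_le_iff_pos, ← zpow_lt_one_iff_right_of_lt_one₀ hw.pos hw.lt_one, ← hz]
    exact pow_lt_one₀ (w.nonneg _) hϖ.lt_one hpos.ne'
  refine (pow_le_pow_iff_left₀ (pow_nonneg (w.nonneg _) _) hω0 hM).1 ?_
  rw [← pow_mul, IsGalois.card_aut_eq_finrank, mul_comm, hdeg, hz, hω]
  simpa only [zpow_one] using zpow_le_zpow_right_of_le_one₀ hw.pos hw.lt_one.le hz1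

variable [IsAlgClosed k]

theorem KummerLevel.ramConductor_le {M E : IntermediateField (K0 p k) (Kbar p k)}
    [Algebra M E] [Algebra (cyc p k l) E] [Algebra (cyc p k l) M]
    [IsScalarTower M E (Kbar p k)] [IsScalarTower (cyc p k l) E (Kbar p k)]
    [IsScalarTower (cyc p k l) M E] [IsGalois M E] [IsGalois (cyc p k l) E]
    [FiniteDimensional (K0 p k) E] (hw : IsPadicAbs w) (hS : IsPrimitiveShape p l δ N) {c : ℕ}
    (hlc : l ≤ c) {α : E} (hα : (α : Kbar p k) ^ p ^ c ∈ cyc p k l)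
    (h0 : KummerLevel w l δ N 0 ((α : Kbar p k) ^ p ^ c)) (hM : M = cycAdjoin p k l α)
    (hE : E = cycAdjoin p k c α) :
    ramConductor (WittVector p k) E M ≤ ((p ^ (c + l - 1) - δ * N : ℕ) : ℝ) := by
  classical
  have := finiteDimensional_of_tower (B := M) (E := E)
  have := finiteDimensional_of_tower (B := cyc p k l) (E := E)
  have := isScalarTower_witt (B := M) (E := E)
  have := isScalarTower_witt (B := cyc p k l) (E := E)
  let _ := Fintype.ofFinite (E ≃ₐ[M] E)
  let _ := Fintype.ofFinite (E ≃ₐ[cyc p k l] E)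
  obtain ⟨ϖ, hϖ⟩ := hw.exists_isValueGen E
  have hwE := hw.absRestrict E
  have hle1 (g : E ≃ₐ[cyc p k l] E) : absRestrict w E (g ϖ - ϖ) ≤ 1 :=
    (hwE.abs_map_sub_le_self hϖ g ϖ).trans hϖ.lt_one.le
  have hfix (h : E ≃ₐ[M] E) : h α = α :=
    map_eq_of_coe_mem h (hM ▸ self_mem_cycAdjoin l (α : Kbar p k))
  have hlev : KummerLevel w l δ N c (α : Kbar p k) := by
    simpa only [pow_zero, pow_one] using h0.root hw hS (zero_add c)
  obtain ⟨π, -, hπ⟩ := hlev.exists_uniformizer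
  refine WildConductor.ramConductor_le M (hw.isMonogenic hϖ) fun g hg => ?_
  have hcard : absRestrict w E ϖ ^ Fintype.card (E ≃ₐ[M] E) ≤ w π := by
    rw [← Nat.card_eq_fintype_card]
    exact hw.pow_card_le hϖ (w.nonneg π) (by rw [hM, hlev.finrank_eq, hπ])
  have hg' : g.restrictScalars (cyc p k l) ≠ 1 := fun h1 =>
    hg (AlgEquiv.ext (DFunLike.congr_fun h1 :))
  calc absRestrict w E ϖ ^ (Fintype.card (E ≃ₐ[M] E) * (p ^ (c + l - 1) - δ * N + 1))
    _ ≤ w π ^ (p ^ (c + l - 1) - δ * N + 1) := by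
        rw [pow_mul]
        exact pow_le_pow_left₀ (pow_nonneg hϖ.pos.le _) hcard _
    _ ≤ ramProd (absRestrict w E) ϖ (MulAction.stabilizer (E ≃ₐ[cyc p k l] E) α)
          (w (g ϖ - ϖ : E)) :=
        pow_le_ramProd_stabilizer hw hS hlc hα h0 hE hϖ hg' (hfix g) (w.nonneg π) hπ
    _ ≤ _ := ramProd_stabilizer_le_prod hle1 hfix (hle1 (g.restrictScalars (cyc p k l)))

theorem KummerLevel.relConductor_le {M E : IntermediateField (K0 p k) (Kbar p k)} (h : M ≤ E)
    (hw : IsPadicAbs w) (hS : IsPrimitiveShape p l δ N) {c : ℕ} (hlc : l ≤ c) {α : Kbar p k}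
    (hα : α ^ p ^ c ∈ cyc p k l) (h0 : KummerLevel w l δ N 0 (α ^ p ^ c))
    (hM : M = cycAdjoin p k l α) (hE : E = cycAdjoin p k c α) :
    relConductor h ≤ ((p ^ (c + l - 1) - δ * N : ℕ) : ℝ) := by
  have hBM : cyc p k l ≤ M := hM ▸ cyc_le_cycAdjoin l α
  let _ : Algebra M E := (inclusion h).toRingHom.toAlgebra
  let _ : Algebra (cyc p k l) E := (inclusion (hBM.trans h)).toRingHom.toAlgebra
  let _ : Algebra (cyc p k l) M := (inclusion hBM).toRingHom.toAlgebra
  have : IsScalarTower M E (Kbar p k) := .of_algebraMap_eq fun _ => rfl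
  have : IsScalarTower (cyc p k l) E (Kbar p k) := .of_algebraMap_eq fun _ => rfl
  have : IsScalarTower (cyc p k l) M E := .of_algebraMap_eq fun _ => rfl
  have hME : IsGaloisExt h := by
    subst hM hE
    exact isGaloisExt_cycAdjoin_mono hlc α
  have hBE : IsGaloisExt (hBM.trans h) := by
    subst hE
    exact isGaloisExt_cyc_cycAdjoin hlc hα
  have : IsGalois M E := hME
  have : IsGalois (cyc p k l) E := hBE
  have : FiniteDimensional (K0 p k) E := hE ▸ inferInstance
  exact ramConductor_le (α := ⟨α, hE ▸ self_mem_cycAdjoin c α⟩) hw hS hlc hα h0 hM hE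

theorem KummerLevel.ramConductor_eq {M E : IntermediateField (K0 p k) (Kbar p k)}
    [Algebra M E] [IsScalarTower M E (Kbar p k)] [IsGalois M E] [FiniteDimensional (K0 p k) E]
    (hw : IsPadicAbs w) (hS : IsPrimitiveShape p l δ N) {j : ℕ} {α : E}
    (hα : KummerLevel w l δ N j ((α : Kbar p k) ^ p))
    (hM : M = cycAdjoin p k l ((α : Kbar p k) ^ p)) (hE : E = cycAdjoin p k l α) :
    ramConductor (WittVector p k) E M = ((p ^ (l + j) - δ * N : ℕ) : ℝ) := by
  have := finiteDimensional_of_tower (B := M) (E := E)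
  have := isScalarTower_witt (B := M) (E := E)
  obtain ⟨σ, -, hσ⟩ := hα.exists_map_ne hw hS hM.le
  have : Nontrivial (E ≃ₐ[M] E) := ⟨σ, 1, fun h => hσ (DFunLike.congr_fun h α)⟩
  obtain ⟨ϖ, hϖE, hϖ, hdiff⟩ := hα.exists_uniformizer_root hw hS
  rw [← hα.finrank_cycAdjoin hw hS, ← hE] at hϖ
  rw [← hE] at hϖE
  have hgen : IsValueGen (absRestrict w E) ⟨ϖ, hϖE⟩ := hw.isValueGen_of_pow_eq E hϖ
  refine WildConductor.ramConductor_eq M (hw.isMonogenic hgen) fun g hg => ?_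
  obtain ⟨τ, hτM, hτ⟩ := exists_lift g
  have hτα : τ α ≠ α := fun h => hg <| AlgEquiv.ext fun x => Subtype.ext <| by
    rw [← hτ]
    exact eq_of_mem_cycAdjoin τ (fun y hy => hτM y (hM ▸ cyc_le_cycAdjoin l _ hy)) h (hE.le x.2)
  rw [absRestrict_apply, absRestrict_apply, AddSubgroupClass.coe_sub, ← hτ]
  exact hdiff τ (fun x hx => hτM x (hM ▸ hx)) hτα

theorem KummerLevel.relConductor_eq {M E : IntermediateField (K0 p k) (Kbar p k)} (h : M ≤ E)
    (hw : IsPadicAbs w) (hS : IsPrimitiveShape p l δ N) {j : ℕ} {α : Kbar p k}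
    (hα : KummerLevel w l δ N j (α ^ p)) (hM : M = cycAdjoin p k l (α ^ p))
    (hE : E = cycAdjoin p k l α) : relConductor h = ((p ^ (l + j) - δ * N : ℕ) : ℝ) := by
  let _ : Algebra M E := (inclusion h).toRingHom.toAlgebra
  have : IsScalarTower M E (Kbar p k) := .of_algebraMap_eq fun _ => rfl
  have hME : IsGaloisExt h := by
    subst hM hE
    exact isGaloisExt_cycAdjoin_pow (Nat.one_le_iff_ne_zero.2 hS.level_ne_zero) α
  have : IsGalois M E := hME
  have : FiniteDimensional (K0 p k) E := hE ▸ inferInstance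
  exact ramConductor_eq (α := ⟨α, hE ▸ self_mem_cycAdjoin l α⟩) hw hS hα hM hE

end Conductor

end WildConductor

end

theorem lemma4p1 (p : ℕ) [Fact p.Prime] (k : Type*) [Field k] [CharP k p] [IsAlgClosed k]
    (l c : ℕ) (hl : 1 ≤ l) (hlc : l ≤ c)
    (a t : WildConductor.cyc p k l) (hat : a = 1 + t)
    (ha : WildConductor.IsPrimitiveElt (WittVector p k) (WildConductor.cyc p k l) p a)
    (ha0 : 0 ≤ WildConductor.cycVal p k l a)
    (α : WildConductor.Kbar p k) (hα : α ^ (p ^ c) = (a : WildConductor.Kbar p k)) :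
    WildConductor.IsGaloisExt (WildConductor.cycAdjoin_mono hlc α) ∧
    WildConductor.IsGaloisExt (WildConductor.cycAdjoin_pow_le l p α) ∧
    ∃ n : ℤ, WildConductor.cycVal p k l t = (n : WithTop ℤ) ∧
      WildConductor.relConductor (WildConductor.cycAdjoin_mono hlc α) ≤
        (p : ℝ) ^ (c + l - 1) - (n : ℝ) ∧
      WildConductor.relConductor (WildConductor.cycAdjoin_pow_le l p α) =
        (p : ℝ) ^ (c + l - 1) - (n : ℝ) := by
  obtain ⟨w, hw⟩ := WildConductor.exists_isPadicAbs p k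
  obtain ⟨δ, N, hS, hval, h0⟩ :=
    hw.exists_kummerLevel (Nat.one_le_iff_ne_zero.1 hl) ha ha0
  obtain rfl : t = a - 1 := eq_sub_of_add_eq' hat.symm
  rw [← hα] at h0
  have hα1 : WildConductor.KummerLevel w l δ N (c - 1) (α ^ p) := by
    simpa only [pow_one] using h0.root hw hS (s := 1) (by omega)
  have hle : δ * N ≤ p ^ (c + l - 1) :=
    hS.mul_lt.le.trans (Nat.pow_le_pow_right (Fact.out : p.Prime).pos (by omega))
  have hbound : (p : ℝ) ^ (c + l - 1) - ((δ * N : ℕ) : ℤ) = (p ^ (c + l - 1) - δ * N : ℕ) := by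
    rw [Nat.cast_sub hle, Nat.cast_pow, Int.cast_natCast]
  refine ⟨WildConductor.isGaloisExt_cycAdjoin_mono hlc α,
    WildConductor.isGaloisExt_cycAdjoin_pow hl α, (δ * N : ℕ), hval, ?_, ?_⟩ <;> rw [hbound]
  · exact h0.relConductor_le _ hw hS hlc (hα ▸ a.2) rfl rfl
  · rw [hα1.relConductor_eq _ hw hS rfl rfl, show l + (c - 1) = c + l - 1 by omega]
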